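/- Let $n\ge 2$ and let $\{A(t)\}_{t=0}^\infty$ be an independent random chain, i.e. a sequence of independent random $n\times n$ matrices that are (almost surely) row-stochastic. Suppose that it has the feedback property with feedback coefficient $\gamma>0$, i.e. $\mathbb E[a_{ii}(t)a_{ij}(t)]\ge\gamma\,\mathbb E[a_{ij}(t)]$ for all $t\ge 0$ and all $i\ne j$, and that the expected chain $\bar A(t)=\mathbb E[A(t)]$ is approximately reciprocal, i.e. there are $p_0,\beta\in(0,\infty)$ such that $$p_0\sum_{t=t_0}^{t_1-1}\sum_{i\in S}\sum_{j\notin S}\bar a_{ij}(t)\le\sum_{t=t_0}^{t_1-1}\sum_{i\notin S}\sum_{j\in S}\bar a_{ij}(t)+\beta\qquad\text{for all } S\subset[n],\ 0\le t_0<t_1.$$ For vectors $u,x\in\mathbb R^n$ with $u$ stochastic let $V_u(x)=\sum_{i=1}^n u_i\,(x_i-u^Tx)^2$. Then the expected chain has a uniformly positive absolute probability sequence: there are $p^*>0$ and stochastic vectors $\pi(t)$, $t\ge 0$, with $\pi(t+1)^T\bar A(t)=\pi(t)^T$ and $\pi_i(t)\ge p^*$ for all $t\ge 0$ and $i\in[n]$.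 Moreover, let $\{\pi(t)\}$ and $p^*>0$ be any such sequence and lower bound, let $\delta\in(0,1)$ and $\epsilon\in(0,1]$, and let $x(t+1)=A(t)x(t)$, where $x(0)$ is deterministic or, more generally, a square-integrable random vector that is independent of $\{A(t)\}_{t=0}^\infty$. Put $t_0=0$ and, for $q\ge1$, let $t_q$ be the least integer $t\ge t_{q-1}+1$ such that $$\Pr\Big(\min_{\emptyset\ne S\subsetneq[n]}\ \sum_{k=t_{q-1}}^{t-1}\ \sum_{i\in S}\sum_{j\notin S}\big(a_{ij}(k)+a_{ji}(k)\big)\ge\delta\Big)\ge\epsilon .$$ Then, for every $q\ge 0$ for which $t_1,\dots,t_q$ exist, all the expectations below are finite and $$\mathbb E\big[V_{\pi(t_q)}(x(t_q))\big]\le\Big(1-\frac{\epsilon\,\delta(1-\delta)^2\,\gamma\,p^*}{(n-1)^2}\Big)^{q}\ \mathbb E\big[V_{\pi(0)}(x(0))\big],$$ and, for every stochastic vector $u\in\mathbb R^n$, $$\mathbb E\big[V_u(x(t_q))\big]\le\frac1{p^*}\Big(1-\frac{\epsilon\,\delta(1-\delta)^2\,\gamma\,p^*}{(n-1)^2}\Big)^{q}\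 \mathbb E\big[V_{\pi(0)}(x(0))\big].$$ -/

import Mathlib

open MeasureTheory ProbabilityTheory

/-- Matrices carry the product σ-algebra: measurability is measurability of all entries. -/
instance matrixMeasurableSpace (n : ℕ) : MeasurableSpace (Matrix (Fin n) (Fin n) ℝ) :=
  inferInstanceAs (MeasurableSpace (Fin n → Fin n → ℝ))

/-- `𝟏ᵀ A_{S S̄} 𝟏`: the total weight of the entries with row in `S` and column outside `S`. -/
def cutWeight {n : ℕ} (A : Matrix (Fin n) (Fin n) ℝ) (S : Finset (Fin n)) : ℝ :=
  ∑ i ∈ S, ∑ j ∈ Sᶜ, A i j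

/-- Approximate reciprocity of a sequence of matrices. -/
def IsApproxReciprocal {n : ℕ} (A : ℕ → Matrix (Fin n) (Fin n) ℝ) : Prop :=
  ∃ p₀ β : ℝ, 0 < p₀ ∧ 0 < β ∧ ∀ (S : Finset (Fin n)) (t₀ t₁ : ℕ), t₀ < t₁ →
    p₀ * ∑ t ∈ Finset.Ico t₀ t₁, cutWeight (A t) S
      ≤ ∑ t ∈ Finset.Ico t₀ t₁, cutWeight (A t) Sᶜ + β

/-- `π` is a (Kolmogorov) absolute probability sequence of the chain `A`: every `π t` is a
stochastic vector and `π(t+1)ᵀ A(t) = π(t)ᵀ`. -/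
def IsAbsProbSeq {n : ℕ} (A : ℕ → Matrix (Fin n) (Fin n) ℝ) (π : ℕ → Fin n → ℝ) : Prop :=
  (∀ t, π t ∈ stdSimplex ℝ (Fin n)) ∧ ∀ t, Matrix.vecMul (π (t + 1)) (A t) = π t

/-- `π` is an absolute probability sequence of `A` all of whose entries are at least `p > 0`. -/
def IsUniformlyPositiveAbsProbSeq {n : ℕ} (A : ℕ → Matrix (Fin n) (Fin n) ℝ)
    (π : ℕ → Fin n → ℝ) (p : ℝ) : Prop :=
  IsAbsProbSeq A π ∧ 0 < p ∧ ∀ t i, p ≤ π t i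

/-- The quadratic comparison function `V_u(x) = ∑ i, u i * (x i - uᵀ x) ^ 2`. -/
def quadComparison {n : ℕ} (u x : Fin n → ℝ) : ℝ :=
  ∑ i, u i * (x i - u ⬝ᵥ x) ^ 2

section RandomChains

variable {n : ℕ} {Ω : Type*} [MeasurableSpace Ω]

/-- An independent random chain: independent random matrices that are almost surely
row-stochastic. -/
structure IsIndependentRandomChain (μ : Measure Ω) (A : ℕ → Ω → Matrix (Fin n) (Fin n) ℝ) :
    Prop where
  measurable : ∀ t, Measurable (A t)
  stochastic : ∀ t, ∀ᵐ ω ∂μ, A t ω ∈ Matrix.rowStochastic ℝ (Fin n)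
  indep : iIndepFun A μ

/-- The expected chain `Ā(t) = 𝔼[A(t)]`, taken entrywise. -/
noncomputable def expectedChain (μ : Measure Ω) (A : ℕ → Ω → Matrix (Fin n) (Fin n) ℝ) :
    ℕ → Matrix (Fin n) (Fin n) ℝ :=
  fun t => Matrix.of fun i j => ∫ ω, A t ω i j ∂μ

/-- The feedback property with feedback coefficient `γ`. -/
def HasFeedback (μ : Measure Ω) (A : ℕ → Ω → Matrix (Fin n) (Fin n) ℝ) (γ : ℝ) : Prop :=
  0 < γ ∧ ∀ (t : ℕ) (i j : Fin n), i ≠ j →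
    γ * ∫ ω, A t ω i j ∂μ ≤ ∫ ω, A t ω i i * A t ω i j ∂μ

/-- The dynamics `x(t+1) = A(t) x(t)` started at `x(0) = x₀`. -/
def trajectory (A : ℕ → Ω → Matrix (Fin n) (Fin n) ℝ) (x₀ : Ω → Fin n → ℝ) :
    ℕ → Ω → Fin n → ℝ
  | 0 => x₀
  | t + 1 => fun ω => Matrix.mulVec (A t ω) (trajectory A x₀ t ω)

/-- The event that, in the time window `[s, t)`, the total flow (in both directions) across every
nontrivial cut `(S, S̄)` is at least `δ`, i.e. the minimum over these cuts is at least `δ`. -/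
def flowEvent (A : ℕ → Ω → Matrix (Fin n) (Fin n) ℝ) (δ : ℝ) (s t : ℕ) : Set Ω :=
  {ω | ∀ S : Finset (Fin n), S.Nonempty → S ≠ Finset.univ →
    δ ≤ ∑ k ∈ Finset.Ico s t, (cutWeight (A k ω) S + cutWeight (A k ω) Sᶜ)}

/-- `τ 0 = 0`, and for `1 ≤ r ≤ q` the time `τ r` is the least `t ≥ τ (r-1) + 1` such that the
event of flow at least `δ` across every cut in `[τ (r-1), t)` has probability at least `ε`.
(So the predicate says in particular that these least times exist up to index `q`.) -/
def IsFlowTimes (μ : Measure Ω) (A : ℕ → Ω → Matrix (Fin n) (Fin n) ℝ) (δ ε : ℝ)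
    (τ : ℕ → ℕ) (q : ℕ) : Prop :=
  τ 0 = 0 ∧ ∀ r < q,
    IsLeast {t : ℕ | τ r + 1 ≤ t ∧ ε ≤ μ.real (flowEvent A δ (τ r) t)} (τ (r + 1))

end RandomChains

/-! ### Uniformly positive absolute probability sequences, by backward propagation and compactness.
-/

section AbsProb

open Finset

variable {n : ℕ}

/-! Positivity of `π`. Propagate the uniform vector backwards through the expected chain from a
horizon `T`. Feedback bounds the diagonal below by `γ / (γ + n)`, so a node keeps a fixed fraction
of its mass in each step. Reciprocity bounds the loss of a set over long times: a large outflow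
forces inflow of at least a definite amount, and this comes from nodes that are heavy
(`sum_window_ge_of_reciprocal`). Induction on the number of heavy nodes (`card_level_succ`) yields a
lower bound independent of `T`, and compactness supplies an infinite sequence.

Decay. Since `π(t+1)ᵀ Ā(t) = π(t)ᵀ` and `A(t)` is independent of `x(t)`, each step lowers `𝔼 V_π` by
at least `γ p` times the expected disagreement `∑ a_ij (x_i - x_j)²`
(`integral_quadComparison_mulVec_add_le`). Pathwise, sorting the coordinates gives a cut whose gap
is a `1 / (n - 1)` fraction of the spread. Flow `δ` across this cut either acts while the gap is
still wide or closes part of it, and both cost disagreement (`sum_disagreement_ge`). The flow event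
depends only on the matrices of its window, hence is independent of the state at the start; taking
expectations produces the factor `ε`. Contraction over successive windows gives the rate, and `V_u ≤
p⁻¹ V_π` covers arbitrary weights. -/

lemma exp_neg_div_le {r l η : ℝ} (hη : 0 < η) (hr : η ≤ r) (hr1 : r ≤ 1) (hl : 1 - r ≤ l) :
    Real.exp (-(l / η)) ≤ r := by
  have hr0 : 0 < r := hη.trans_le hr
  -- This is `log r ≥ 1 - 1 / r = -(1 - r) / r`, with the denominator `r` lowered to `η`.
  have h1 : r⁻¹ - 1 ≤ l / η := by
    have : r⁻¹ - 1 = (1 - r) / r := by field_simp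
    rw [this]
    exact div_le_div₀ (by linarith) hl hη hr
  have h2 : r⁻¹ ≤ Real.exp (r⁻¹ - 1) := by
    have := Real.add_one_le_exp (r⁻¹ - 1); linarith
  calc Real.exp (-(l / η)) ≤ Real.exp (-(r⁻¹ - 1)) := Real.exp_le_exp.2 (by linarith)
    _ = (Real.exp (r⁻¹ - 1))⁻¹ := Real.exp_neg _
    _ ≤ r := inv_le_of_inv_le₀ hr0 h2

lemma cutWeight_nonneg {B : Matrix (Fin n) (Fin n) ℝ} (hB : B ∈ Matrix.rowStochastic ℝ (Fin n))
    (S : Finset (Fin n)) : 0 ≤ cutWeight B S :=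
  sum_nonneg fun i _ => sum_nonneg fun j _ => hB.1 i j

lemma cutWeight_le {B : Matrix (Fin n) (Fin n) ℝ} (hB : B ∈ Matrix.rowStochastic ℝ (Fin n))
    (S : Finset (Fin n)) : cutWeight B S ≤ n := by
  have h : ∀ i ∈ S, ∑ j ∈ Sᶜ, B i j ≤ 1 := fun i _ => by
    rw [← Matrix.sum_row_of_mem_rowStochastic hB i]
    exact sum_le_sum_of_subset_of_nonneg (subset_univ _) fun j _ _ => hB.1 i j
  calc cutWeight B S ≤ ∑ i ∈ S, (1 : ℝ) := sum_le_sum h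
    _ = S.card := by simp
    _ ≤ n := by exact_mod_cast (card_le_univ S).trans_eq (Fintype.card_fin n)

lemma diag_mul_le_vecMul {B : Matrix (Fin n) (Fin n) ℝ}
    (hB : B ∈ Matrix.rowStochastic ℝ (Fin n)) {η : ℝ} (hη : ∀ i, η ≤ B i i)
    {w : Fin n → ℝ} (hw : ∀ i, 0 ≤ w i) (j : Fin n) : η * w j ≤ Matrix.vecMul w B j := by
  calc η * w j ≤ w j * B j j := by rw [mul_comm]; exact mul_le_mul_of_nonneg_left (hη j) (hw j)
    _ ≤ ∑ i, w i * B i j :=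
      single_le_sum (f := fun i => w i * B i j) (fun i _ => mul_nonneg (hw i) (hB.1 i j))
        (mem_univ j)

/-- The mass of `S` shrinks at most exponentially in the flow out of `S`, and it gains from the
flow into `S`. -/
lemma sum_vecMul_ge {B : Matrix (Fin n) (Fin n) ℝ}
    (hB : B ∈ Matrix.rowStochastic ℝ (Fin n)) {η : ℝ} (hη0 : 0 < η) (hη : ∀ i, η ≤ B i i)
    {w : Fin n → ℝ} (hw : ∀ i, 0 ≤ w i) {S : Finset (Fin n)} {m : ℝ} (hm : ∀ i ∈ Sᶜ, m ≤ w i) :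
    Real.exp (-(cutWeight B S / η)) * ∑ i ∈ S, w i + m * cutWeight B Sᶜ
      ≤ ∑ j ∈ S, Matrix.vecMul w B j := by
  have h1 : ∑ j ∈ S, Matrix.vecMul w B j
      = ∑ i ∈ S, w i * ∑ j ∈ S, B i j + ∑ i ∈ Sᶜ, w i * ∑ j ∈ S, B i j := by
    simp only [Matrix.vecMul, dotProduct, mul_sum]
    rw [sum_comm, ← sum_add_sum_compl S]
  rw [h1]
  refine add_le_add ?_ ?_
  · rw [mul_sum]
    refine sum_le_sum fun i hi => ?_
    rw [mul_comm]
    refine mul_le_mul_of_nonneg_left ?_ (hw i)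
    have hrow := Matrix.sum_row_of_mem_rowStochastic hB i
    rw [← sum_add_sum_compl S] at hrow
    refine exp_neg_div_le hη0 ((hη i).trans ?_) ?_ ?_
    · exact single_le_sum (f := fun j => B i j) (fun j _ => hB.1 i j) hi
    · have : 0 ≤ ∑ j ∈ Sᶜ, B i j := sum_nonneg fun j _ => hB.1 i j
      linarith
    · have : ∑ j ∈ Sᶜ, B i j ≤ cutWeight B S :=
        single_le_sum (f := fun i => ∑ j ∈ Sᶜ, B i j)
          (fun i _ => sum_nonneg fun j _ => hB.1 i j) hi
      linarith
  · rw [cutWeight, compl_compl, mul_sum]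
    exact sum_le_sum fun i hi =>
      mul_le_mul_of_nonneg_right (hm i hi) (sum_nonneg fun j _ => hB.1 i j)

section Window

variable {B : ℕ → Matrix (Fin n) (Fin n) ℝ} {w : ℕ → Fin n → ℝ} {η : ℝ}

/-- Iterates `sum_vecMul_ge`. The loss factors multiply; each gain is damped only by later losses,
so applying the full window's factor to it is a weakening. -/
lemma sum_window_ge (hB : ∀ s, B s ∈ Matrix.rowStochastic ℝ (Fin n)) (hη0 : 0 < η)
    (hη : ∀ s i, η ≤ B s i i) (hw0 : ∀ s i, 0 ≤ w s i)
    (hw : ∀ s, w (s + 1) = Matrix.vecMul (w s) (B s)) {S : Finset (Fin n)} {m : ℝ} (hm0 : 0 ≤ m)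
    {a b : ℕ} (hab : a ≤ b) (hm : ∀ s, a ≤ s → s < b → ∀ i ∈ Sᶜ, m ≤ w s i) :
    Real.exp (-((∑ s ∈ Ico a b, cutWeight (B s) S) / η))
        * (∑ i ∈ S, w a i + m * ∑ s ∈ Ico a b, cutWeight (B s) Sᶜ) ≤ ∑ i ∈ S, w b i := by
  induction b, hab using Nat.le_induction with
  | base => simp
  | succ b hab ih =>
    specialize ih fun s h1 h2 => hm s h1 (h2.trans b.lt_succ_self)
    have hstep := sum_vecMul_ge (hB b) hη0 (hη b) (hw0 b) (hm b hab b.lt_succ_self)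
    rw [← hw] at hstep
    rw [sum_Ico_succ_top hab, sum_Ico_succ_top hab]
    set F := ∑ s ∈ Ico a b, cutWeight (B s) S
    set G := ∑ s ∈ Ico a b, cutWeight (B s) Sᶜ
    set f := cutWeight (B b) S
    set g := cutWeight (B b) Sᶜ
    have hF : 0 ≤ F := sum_nonneg fun s _ => cutWeight_nonneg (hB s) S
    have hf : 0 ≤ f := cutWeight_nonneg (hB b) S
    have hg : 0 ≤ g := cutWeight_nonneg (hB b) Sᶜ
    have he : Real.exp (-((F + f) / η)) = Real.exp (-(f / η)) * Real.exp (-(F / η)) := by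
      rw [← Real.exp_add]; congr 1; ring
    have he1 : Real.exp (-((F + f) / η)) ≤ 1 :=
      Real.exp_le_one_iff.2 (by have : 0 ≤ (F + f) / η := by positivity
                                linarith)
    have h1 := mul_le_mul_of_nonneg_left ih (Real.exp_pos (-(f / η))).le
    have h2 := mul_le_mul_of_nonneg_right he1 (mul_nonneg hm0 hg)
    calc Real.exp (-((F + f) / η)) * (∑ i ∈ S, w a i + m * (G + g))
        = Real.exp (-(f / η)) * (Real.exp (-(F / η)) * (∑ i ∈ S, w a i + m * G))
          + Real.exp (-((F + f) / η)) * (m * g) := by rw [he]; ring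
      _ ≤ Real.exp (-(f / η)) * ∑ i ∈ S, w b i + m * g := by linarith
      _ ≤ _ := hstep

/-- Suffix sums, extended backwards from `b`, rise by at most `N` per step, so they cannot jump over
`[C, C + N]`. -/
lemma exists_suffix_window {f : ℕ → ℝ} {C N : ℝ} (hC : 0 ≤ C) (hN : 0 ≤ N) (hf : ∀ s, f s ≤ N)
    {a b : ℕ} (hab : a ≤ b) :
    ∑ s ∈ Ico a b, f s ≤ C + N ∨
      ∃ c, a ≤ c ∧ c ≤ b ∧ C ≤ ∑ s ∈ Ico c b, f s ∧ ∑ s ∈ Ico c b, f s ≤ C + N := by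
  induction hab using Nat.decreasingInduction with
  | self => left; simp; positivity
  | of_succ a hab ih =>
    rcases ih with ih | ⟨c, h1, h2, h3⟩
    · by_cases h : C ≤ ∑ s ∈ Ico (a + 1) b, f s
      · exact Or.inr ⟨a + 1, a.le_succ, hab, h, ih⟩
      · left
        rw [sum_eq_sum_Ico_succ_bot hab]
        have := hf a
        linarith
    · exact Or.inr ⟨c, by omega, h2, h3⟩

/-- If the outflow is moderate, the initial mass survives up to the exponential factor. Otherwise a
suffix has outflow between `(β + 1) / p` and `(β + 1) / p + n`. By reciprocity its inflow is at
least `1`, bringing mass `m ≥ W` whatever was lost earlier. -/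
lemma sum_window_ge_of_reciprocal (hB : ∀ s, B s ∈ Matrix.rowStochastic ℝ (Fin n)) (hη0 : 0 < η)
    (hη : ∀ s i, η ≤ B s i i) (hw0 : ∀ s i, 0 ≤ w s i)
    (hw : ∀ s, w (s + 1) = Matrix.vecMul (w s) (B s)) {T : ℕ} {p β : ℝ} (hp : 0 < p) (hβ : 0 < β)
    (hrec : ∀ (S : Finset (Fin n)) (a b : ℕ), a ≤ b → b ≤ T →
      p * ∑ s ∈ Ico a b, cutWeight (B s) S ≤ ∑ s ∈ Ico a b, cutWeight (B s) Sᶜ + β)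
    {S : Finset (Fin n)} {m W : ℝ} (hm0 : 0 ≤ m) {a b : ℕ} (hab : a ≤ b) (hbT : b ≤ T)
    (hm : ∀ s, a ≤ s → s < b → ∀ i ∈ Sᶜ, m ≤ w s i) (hW0 : 0 ≤ W) (hWm : W ≤ m)
    (hW : W ≤ ∑ i ∈ S, w a i) :
    Real.exp (-(((β + 1) / p + n) / η)) * W ≤ ∑ i ∈ S, w b i := by
  have key : ∀ F X : ℝ, F ≤ (β + 1) / p + n → W ≤ X →
      Real.exp (-(((β + 1) / p + n) / η)) * W ≤ Real.exp (-(F / η)) * X := fun F X hF hX => by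
    refine mul_le_mul (Real.exp_le_exp.2 (neg_le_neg ?_)) hX hW0 (Real.exp_pos _).le
    exact div_le_div_of_nonneg_right hF hη0.le
  rcases exists_suffix_window (f := fun s => cutWeight (B s) S) (C := (β + 1) / p) (N := n)
    (by positivity) (by positivity) (fun s => cutWeight_le (hB s) S) hab with h | ⟨c, hac, hcb, h1, h2⟩
  · refine (key _ _ h ?_).trans (sum_window_ge hB hη0 hη hw0 hw hm0 hab hm)
    have : 0 ≤ m * ∑ s ∈ Ico a b, cutWeight (B s) Sᶜ :=
      mul_nonneg hm0 (sum_nonneg fun s _ => cutWeight_nonneg (hB s) _)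
    linarith
  · refine (key _ _ h2 ?_).trans (sum_window_ge hB hη0 hη hw0 hw hm0 hcb
      fun s h3 h4 => hm s (hac.trans h3) h4)
    have h3 := hrec S c b hcb hbT
    have h4 : β + 1 ≤ p * ∑ s ∈ Ico c b, cutWeight (B s) S := by
      rwa [div_le_iff₀' hp] at h1
    have h5 : m * 1 ≤ m * ∑ s ∈ Ico c b, cutWeight (B s) Sᶜ :=
      mul_le_mul_of_nonneg_left (by linarith) hm0
    have h6 : 0 ≤ ∑ i ∈ S, w c i := sum_nonneg fun i _ => hw0 c i
    linarith

/-- If at all times at least `k < n` nodes carry mass `≥ L`, then at all times at least `k + 1`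
nodes carry mass at least a fixed fraction of `L`. -/
lemma card_level_succ (hB : ∀ s, B s ∈ Matrix.rowStochastic ℝ (Fin n)) (hη0 : 0 < η) (hη1 : η ≤ 1)
    (hη : ∀ s i, η ≤ B s i i) (hw0 : ∀ s i, 0 ≤ w s i)
    (hw : ∀ s, w (s + 1) = Matrix.vecMul (w s) (B s)) {T : ℕ} {p β : ℝ} (hp : 0 < p) (hβ : 0 < β)
    (hrec : ∀ (S : Finset (Fin n)) (a b : ℕ), a ≤ b → b ≤ T →
      p * ∑ s ∈ Ico a b, cutWeight (B s) S ≤ ∑ s ∈ Ico a b, cutWeight (B s) Sᶜ + β)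
    {k : ℕ} (hk : k < n) {L : ℝ} (hL : 0 < L) (hLinit : ∀ i, L ≤ w 0 i)
    (hcard : ∀ s ≤ T, k ≤ (univ.filter fun i => L ≤ w s i).card) :
    ∀ s ≤ T, k + 1 ≤ (univ.filter fun i =>
      Real.exp (-(((β + 1) / p + n) / η)) * η ^ 2 / n * L ≤ w s i).card := by
  intro s hsT
  by_contra hcon
  push Not at hcon
  set E := Real.exp (-(((β + 1) / p + n) / η)) with hE
  have hE0 : 0 < E := Real.exp_pos _
  have hE1 : E ≤ 1 := Real.exp_le_one_iff.2 (by
    have : 0 ≤ ((β + 1) / p + n) / η := by positivity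
    linarith)
  have hn : (1 : ℝ) ≤ n := by exact_mod_cast (by omega : 1 ≤ n)
  have hηL : η * L ≤ L := by nlinarith
  have hη2 : η ^ 2 * L ≤ η * L := by nlinarith [mul_pos hη0 hL]
  have hL' : E * η ^ 2 / n * L ≤ η * L := by
    refine le_trans ?_ hη2
    refine mul_le_mul_of_nonneg_right ?_ hL.le
    rw [div_le_iff₀ (by linarith)]
    have : 0 < η ^ 2 := by positivity
    nlinarith
  -- The threshold `η * L` is what a node of mass `L` is sure to keep after one step. Below, `s₀` is
  -- the last time up to `s` with more than `k` nodes above it.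
  let U : ℕ → Finset (Fin n) := fun s => univ.filter fun i => η * L ≤ w s i
  have hmemU : ∀ s i, i ∈ U s ↔ η * L ≤ w s i := fun s i => by simp [U]
  have hU0 : k + 1 ≤ (U 0).card := by
    have : U 0 = univ := by
      ext i; simpa [hmemU] using hηL.trans (hLinit i)
    rw [this]; simpa using hk
  set s₀ := Nat.findGreatest (fun s => k + 1 ≤ (U s).card) s with hs₀
  have hs₀P : k + 1 ≤ (U s₀).card :=
    Nat.findGreatest_spec (P := fun s => k + 1 ≤ (U s).card) (Nat.zero_le s) hU0
  have hs₀s : s₀ < s := by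
    refine lt_of_le_of_ne (Nat.findGreatest_le s) fun h => ?_
    rw [h] at hs₀P
    have : U s ⊆ univ.filter fun i => E * η ^ 2 / n * L ≤ w s i := fun i hi => by
      simpa using hL'.trans ((hmemU s i).1 hi)
    have := card_le_card this
    omega
  have hUcard : ∀ r, s₀ < r → r ≤ s → (U r).card ≤ k := fun r h1 h2 => by
    by_contra h
    have : r ≤ s₀ := Nat.le_findGreatest (P := fun s => k + 1 ≤ (U s).card) h2 (by omega)
    omega
  -- After `s₀` no mass lies in `[η * L, L)`: at least `k` nodes reach `L` and at most `k` reach `η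
  -- * L`. Hence nobody leaves `U`, and it stays constant up to `s`.
  have hUeq : ∀ r, s₀ < r → r ≤ s → (univ.filter fun i => L ≤ w r i) = U r := fun r h1 h2 => by
    refine eq_of_subset_of_card_le (fun i hi => ?_)
      ((hUcard r h1 h2).trans (hcard r (h2.trans hsT)))
    exact (hmemU r i).2 (hηL.trans (by simpa using hi))
  have hLU : ∀ r, s₀ < r → r ≤ s → ∀ i ∈ U r, L ≤ w r i := fun r h1 h2 i hi => by
    rw [← hUeq r h1 h2] at hi; simpa using hi
  have hconst : ∀ r, s₀ + 1 ≤ r → r ≤ s → U r = U (s₀ + 1) := fun r h1 => by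
    induction r, h1 using Nat.le_induction with
    | base => exact fun _ => rfl
    | succ r h1 ih =>
      intro h2
      rw [← ih (by omega)]
      symm
      refine eq_of_subset_of_card_le (fun i hi => (hmemU _ i).2 ?_) ?_
      · rw [hw]
        refine le_trans ?_ (diag_mul_le_vecMul (hB r) (hη r) (hw0 r) i)
        exact mul_le_mul_of_nonneg_left (hLU r h1 (by omega) i hi) hη0.le
      · rw [← hUeq r h1 (by omega)]
        exact (hUcard _ (by omega) h2).trans (hcard r (by omega))
  -- The node `j` dropping out of `U` still has mass at least `η ^ 2 * L` one step later, which
  -- seeds the complement of `U` for the window estimate.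
  obtain ⟨j, hj, hjU⟩ : ∃ j ∈ U s₀, j ∉ U (s₀ + 1) := by
    by_contra h
    push Not at h
    have := card_le_card (show U s₀ ⊆ U (s₀ + 1) from h)
    have := hUcard (s₀ + 1) (by omega) (by omega)
    omega
  have hmain := sum_window_ge_of_reciprocal hB hη0 hη hw0 hw hp hβ hrec
    (S := (U (s₀ + 1))ᶜ) (m := L) (W := η ^ 2 * L) hL.le (a := s₀ + 1) (b := s) (by omega) hsT
    (fun r h1 h2 i hi => by
      rw [compl_compl, ← hconst r h1 h2.le] at hi
      exact hLU r h1 h2.le i hi)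
    (by positivity) (hη2.trans hηL)
    (by
      calc η ^ 2 * L = η * (η * L) := by ring
        _ ≤ η * w s₀ j := mul_le_mul_of_nonneg_left ((hmemU _ _).1 hj) hη0.le
        _ ≤ w (s₀ + 1) j := by rw [hw]; exact diag_mul_le_vecMul (hB _) (hη _) (hw0 _) j
        _ ≤ _ := single_le_sum (f := fun i => w (s₀ + 1) i) (fun i _ => hw0 _ i)
          (mem_compl.2 hjU))
  rw [← hE] at hmain
  -- Pigeonhole: the complement has at most `n` nodes, so one of them carries a share `1 / n` of its
  -- mass. With the `k` nodes of `U` this makes `k + 1`.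
  obtain ⟨i, hi, hiw⟩ : ∃ i ∈ (U (s₀ + 1))ᶜ, E * η ^ 2 / n * L ≤ w s i := by
    by_contra h
    push Not at h
    have hne : ((U (s₀ + 1))ᶜ).Nonempty := ⟨j, mem_compl.2 hjU⟩
    have h1 := sum_lt_sum_of_nonempty hne h
    rw [sum_const, nsmul_eq_mul] at h1
    have h2 : ((((U (s₀ + 1))ᶜ).card : ℕ) : ℝ) ≤ n := by
      exact_mod_cast (card_le_univ _).trans_eq (Fintype.card_fin n)
    have h3 : 0 ≤ E * η ^ 2 / n * L := by positivity
    have h4 := mul_le_mul_of_nonneg_right h2 h3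
    have h5 : (n : ℝ) * (E * η ^ 2 / n * L) = E * (η ^ 2 * L) := by field_simp
    linarith
  have hsub : insert i (U (s₀ + 1)) ⊆ univ.filter fun i => E * η ^ 2 / n * L ≤ w s i := by
    intro l hl
    rcases mem_insert.1 hl with rfl | hl
    · simpa using hiw
    · rw [← hconst s (by omega) le_rfl, hmemU] at hl
      simpa using hL'.trans hl
  have h1 := card_le_card hsub
  rw [card_insert_of_notMem (mem_compl.1 hi), ← hUeq (s₀ + 1) (Nat.lt_succ_self _) hs₀s] at h1
  have := hcard (s₀ + 1) (by omega)
  omega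

lemma vecMul_mem_stdSimplex {B : Matrix (Fin n) (Fin n) ℝ}
    (hB : B ∈ Matrix.rowStochastic ℝ (Fin n)) {w : Fin n → ℝ} (hw : w ∈ stdSimplex ℝ (Fin n)) :
    Matrix.vecMul w B ∈ stdSimplex ℝ (Fin n) := by
  refine ⟨Matrix.nonneg_vecMul_of_mem_rowStochastic hB hw.1, ?_⟩
  have := Matrix.vecMul_dotProduct_one_eq_one_rowStochastic hB (x := w)
    (by simpa [dotProduct] using hw.2)
  simpa [dotProduct] using this

/-- The uniform lower bound on the masses, as a function of the constants only. -/
noncomputable def massBound (n : ℕ) (η p β : ℝ) : ℝ :=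
  (Real.exp (-(((β + 1) / p + n) / η)) * η ^ 2 / n) ^ n * (1 / n)

lemma massBound_pos (hn : 0 < n) (hη0 : 0 < η) (p β : ℝ) : 0 < massBound n η p β := by
  have : (0 : ℝ) < n := by exact_mod_cast hn
  unfold massBound
  positivity

lemma massBound_le (hn : 0 < n) (hB : ∀ s, B s ∈ Matrix.rowStochastic ℝ (Fin n)) (hη0 : 0 < η)
    (hη1 : η ≤ 1) (hη : ∀ s i, η ≤ B s i i) (hinit : ∀ i, w 0 i = 1 / n)
    (hw : ∀ s, w (s + 1) = Matrix.vecMul (w s) (B s)) {T : ℕ} {p β : ℝ} (hp : 0 < p) (hβ : 0 < β)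
    (hrec : ∀ (S : Finset (Fin n)) (a b : ℕ), a ≤ b → b ≤ T →
      p * ∑ s ∈ Ico a b, cutWeight (B s) S ≤ ∑ s ∈ Ico a b, cutWeight (B s) Sᶜ + β) :
    ∀ s ≤ T, ∀ i, massBound n η p β ≤ w s i := by
  have hn0 : (1 : ℝ) ≤ n := by exact_mod_cast hn
  have hw0 : ∀ s i, 0 ≤ w s i := fun s => by
    induction s with
    | zero => intro i; rw [hinit]; positivity
    | succ s ih => rw [hw]; exact Matrix.nonneg_vecMul_of_mem_rowStochastic (hB s) ih
  set c := Real.exp (-(((β + 1) / p + n) / η)) * η ^ 2 / n with hc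
  have hc0 : 0 < c := by positivity
  have hc1 : c ≤ 1 := by
    have hE1 : Real.exp (-(((β + 1) / p + n) / η)) ≤ 1 := Real.exp_le_one_iff.2 (by
      have : 0 ≤ ((β + 1) / p + n) / η := by positivity
      linarith)
    have : η ^ 2 ≤ 1 := pow_le_one₀ hη0.le hη1
    rw [hc, div_le_one (by linarith)]
    exact (mul_le_one₀ hE1 (by positivity) this).trans hn0
  have hlev : ∀ k ≤ n, ∀ s ≤ T, k ≤ (univ.filter fun i => c ^ k * (1 / n) ≤ w s i).card := by
    intro k
    induction k with
    | zero => intro _ s _; exact Nat.zero_le _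
    | succ k ih =>
      intro hk s hs
      have := card_level_succ hB hη0 hη1 hη hw0 hw hp hβ hrec (k := k) (by omega)
        (L := c ^ k * (1 / n)) (by positivity)
        (fun i => by
          rw [hinit]
          exact mul_le_of_le_one_left (by positivity) (pow_le_one₀ hc0.le hc1))
        (ih (by omega)) s hs
      rw [← hc] at this
      rwa [show c ^ (k + 1) * (1 / (n : ℝ)) = c * (c ^ k * (1 / n)) by ring]
  intro s hs i
  have h1 := hlev n le_rfl s hs
  have h2 : (univ.filter fun i => c ^ n * (1 / (n : ℝ)) ≤ w s i) = univ :=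
    eq_univ_of_card _ (le_antisymm (card_le_univ _) (by simpa using h1))
  have := h2 ▸ mem_univ i
  simpa [massBound, ← hc] using this

end Window

/-- An approximately reciprocal chain with uniformly positive diagonal has a uniformly positive
absolute probability sequence. -/
theorem exists_isUniformlyPositiveAbsProbSeq (hn : 0 < n) {A : ℕ → Matrix (Fin n) (Fin n) ℝ}
    (hA : ∀ t, A t ∈ Matrix.rowStochastic ℝ (Fin n)) {η : ℝ} (hη0 : 0 < η)
    (hη : ∀ t i, η ≤ A t i i) (hrec : IsApproxReciprocal A) :
    ∃ (π : ℕ → Fin n → ℝ) (p : ℝ), IsUniformlyPositiveAbsProbSeq A π p := by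
  obtain ⟨p, β, hp, hβ, hrec⟩ := hrec
  have hη1 : η ≤ 1 := (hη 0 ⟨0, hn⟩).trans (Matrix.le_one_of_mem_rowStochastic (hA 0))
  set c := massBound n η p β
  have hc : 0 < c := massBound_pos hn hη0 p β
  have hn0 : (0 : ℝ) < n := by exact_mod_cast hn
  -- Sequences satisfying the constraints up to horizon `T`: nested closed subsets of a compact
  -- product of simplices.
  let K : ℕ → Set (ℕ → Fin n → ℝ) := fun T =>
    (Set.univ.pi fun _ => stdSimplex ℝ (Fin n)) ∩ {π | ∀ t i, t ≤ T → c ≤ π t i} ∩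
      {π | ∀ t, t < T → Matrix.vecMul (π (t + 1)) (A t) = π t}
  have hclosed : ∀ T, IsClosed (K T) := fun T => by
    refine ((isClosed_set_pi fun _ _ => isClosed_stdSimplex ℝ (Fin n)).inter ?_).inter ?_
    · simp only [Set.ofPred_forall]
      refine isClosed_iInter fun t => isClosed_iInter fun i => isClosed_iInter fun _ => ?_
      exact isClosed_le (by fun_prop) (by fun_prop)
    · simp only [Set.ofPred_forall]
      refine isClosed_iInter fun t => isClosed_iInter fun _ => ?_
      exact isClosed_eq (Continuous.matrix_vecMul (by fun_prop) continuous_const) (by fun_prop)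
  obtain ⟨π, hπ⟩ : (⋂ T, K T).Nonempty := by
    refine IsCompact.nonempty_iInter_of_sequence_nonempty_isCompact_isClosed K (fun T π hπ => ?_)
      (fun T => ?_) ?_ hclosed
    · exact ⟨⟨hπ.1.1, fun t i ht => hπ.1.2 t i (by omega)⟩, fun t ht => hπ.2 t (by omega)⟩
    · let w : ℕ → Fin n → ℝ := fun s =>
        Nat.rec (fun _ => 1 / (n : ℝ)) (fun s v => Matrix.vecMul v (A (T - 1 - s))) s
      have hw : ∀ s, w (s + 1) = Matrix.vecMul (w s) (A (T - 1 - s)) := fun s => rfl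
      have hws : ∀ s, w s ∈ stdSimplex ℝ (Fin n) := fun s => by
        induction s with
        | zero => exact ⟨fun i => (one_div_pos.2 hn0).le, by simp [w, hn0.ne']⟩
        | succ s ih => rw [hw]; exact vecMul_mem_stdSimplex (hA _) ih
      have hbound := massBound_le (w := w) (B := fun s => A (T - 1 - s)) (T := T) hn
        (fun s => hA _) hη0 hη1 (fun s => hη _) (fun i => rfl) hw hp hβ
        (fun S a b hab hbT => by
          rcases hab.eq_or_lt with rfl | hab
          · simpa using hβ.le
          · have hT : T - 1 + 1 = T := by omega
            -- Time reversal turns the window `[a, b)` into `[T - b, T - a)`, and reciprocity holds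
            -- on every window.
            have e : ∀ S : Finset (Fin n), ∑ s ∈ Ico a b, cutWeight (A (T - 1 - s)) S
                = ∑ t ∈ Ico (T - b) (T - a), cutWeight (A t) S := fun S => by
              rw [sum_Ico_reflect (fun t => cutWeight (A t) S) a (by omega), hT]
            rw [e, e]
            exact hrec S _ _ (by omega))
      -- For `t > T` truncated subtraction gives the uniform vector, which lies in the simplex as
      -- required.
      refine ⟨fun t => w (T - t), ⟨fun t _ => hws _, fun t i _ => hbound _ (by omega) i⟩,
        fun t ht => ?_⟩
      have h1 : T - t = (T - (t + 1)) + 1 := by omega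
      have h2 : T - 1 - (T - (t + 1)) = t := by omega
      change Matrix.vecMul (w (T - (t + 1))) (A t) = w (T - t)
      rw [h1, hw, h2]
    · refine IsCompact.of_isClosed_subset (isCompact_univ_pi fun _ => isCompact_stdSimplex ℝ (Fin n))
        (hclosed 0) fun π hπ => hπ.1.1
  rw [Set.mem_iInter] at hπ
  exact ⟨π, c, ⟨fun t => (hπ 0).1.1 t trivial, fun t => (hπ (t + 1)).2 t t.lt_succ_self⟩, hc,
    fun t i => (hπ t).1.2 t i le_rfl⟩

end AbsProb

/-! ### Pathwise estimates: flow across cuts forces disagreement. -/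

section Disagreement

open Finset

variable {n : ℕ}

/-- The variance is `D - d ^ 2` with `D = ∑ a j * (x k - x j) ^ 2` and `d = ∑ a j * (x k - x j)`.
The term `j = k` vanishes, so Cauchy–Schwarz over the other indices gives `d ^ 2 ≤ (1 - a k) * D`.
-/
lemma sq_sum_add_le_sum_sq {ι : Type*} [DecidableEq ι] {s : Finset ι} {a x : ι → ℝ}
    (ha : ∀ i ∈ s, 0 ≤ a i) (hsum : ∑ i ∈ s, a i = 1) {k : ι} (hk : k ∈ s) :
    (∑ j ∈ s, a j * x j) ^ 2 + a k * ∑ j ∈ s, a j * (x k - x j) ^ 2 ≤ ∑ j ∈ s, a j * x j ^ 2 := by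
  have h1 : ∑ j ∈ s, a j * (x k - x j) ^ 2
      = x k ^ 2 - 2 * x k * ∑ j ∈ s, a j * x j + ∑ j ∈ s, a j * x j ^ 2 := by
    calc ∑ j ∈ s, a j * (x k - x j) ^ 2
        = ∑ j ∈ s, (x k ^ 2 * a j - 2 * x k * (a j * x j) + a j * x j ^ 2) :=
          sum_congr rfl fun j _ => by ring
      _ = _ := by rw [sum_add_distrib, sum_sub_distrib, ← mul_sum, ← mul_sum, hsum, mul_one]
  have h2 : ∑ j ∈ s, a j * (x k - x j) = x k - ∑ j ∈ s, a j * x j := by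
    calc ∑ j ∈ s, a j * (x k - x j) = ∑ j ∈ s, (x k * a j - a j * x j) :=
          sum_congr rfl fun j _ => by ring
      _ = _ := by rw [sum_sub_distrib, ← mul_sum, hsum, mul_one]
  have e1 : ∑ j ∈ s.erase k, a j * (x k - x j) ^ 2 = ∑ j ∈ s, a j * (x k - x j) ^ 2 := by
    rw [← add_sum_erase s _ hk]; simp
  have e2 : ∑ j ∈ s.erase k, a j * (x k - x j) = ∑ j ∈ s, a j * (x k - x j) := by
    rw [← add_sum_erase s _ hk]; simp
  have e3 : ∑ j ∈ s.erase k, a j = 1 - a k := by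
    rw [← hsum, ← add_sum_erase s _ hk]; ring
  have hcs := sum_sq_le_sum_mul_sum_of_sq_le_mul (s.erase k) (r := fun j => a j * (x k - x j))
    (f := a) (g := fun j => a j * (x k - x j) ^ 2) (fun j hj => ha j (mem_of_mem_erase hj))
    (fun j hj => mul_nonneg (ha j (mem_of_mem_erase hj)) (sq_nonneg _)) (fun j _ => le_of_eq (by ring))
  rw [e1, e2, e3, h2] at hcs
  nlinarith [h1, hcs]

lemma quadComparison_nonneg {u : Fin n → ℝ} (hu : u ∈ stdSimplex ℝ (Fin n)) (x : Fin n → ℝ) :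
    0 ≤ quadComparison u x :=
  sum_nonneg fun i _ => mul_nonneg (hu.1 i) (sq_nonneg _)

lemma sum_mul_sub_sq {u : Fin n → ℝ} (hu : ∑ i, u i = 1) (x : Fin n → ℝ) (c : ℝ) :
    ∑ i, u i * (x i - c) ^ 2 = ∑ i, u i * x i ^ 2 - 2 * c * (u ⬝ᵥ x) + c ^ 2 := by
  calc ∑ i, u i * (x i - c) ^ 2
      = ∑ i, (u i * x i ^ 2 - 2 * c * (u i * x i) + c ^ 2 * u i) :=
        sum_congr rfl fun i _ => by ring
    _ = _ := by
      rw [sum_add_distrib, sum_sub_distrib, ← mul_sum, ← mul_sum, hu, mul_one]; rfl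

lemma quadComparison_eq {u : Fin n → ℝ} (hu : ∑ i, u i = 1) (x : Fin n → ℝ) :
    quadComparison u x = ∑ i, u i * x i ^ 2 - (u ⬝ᵥ x) ^ 2 := by
  rw [quadComparison, sum_mul_sub_sq hu]; ring

lemma quadComparison_le_sum {u : Fin n → ℝ} (hu : ∑ i, u i = 1) (x : Fin n → ℝ) (c : ℝ) :
    quadComparison u x ≤ ∑ i, u i * (x i - c) ^ 2 := by
  rw [quadComparison_eq hu, sum_mul_sub_sq hu]
  nlinarith [sq_nonneg (u ⬝ᵥ x - c)]

/-- The weighted mean minimises the squared deviation, so `V_u` may be centred at `v ⬝ᵥ x`; then `u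
i ≤ 1 ≤ p⁻¹ * v i` termwise. -/
lemma quadComparison_le_inv_mul {u v : Fin n → ℝ} {p : ℝ} (hu : u ∈ stdSimplex ℝ (Fin n))
    (hp : 0 < p) (hv : ∀ i, p ≤ v i) (x : Fin n → ℝ) :
    quadComparison u x ≤ p⁻¹ * quadComparison v x := by
  refine (quadComparison_le_sum hu.2 x (v ⬝ᵥ x)).trans ?_
  rw [quadComparison, mul_sum]
  refine sum_le_sum fun i _ => ?_
  rw [← mul_assoc]
  refine mul_le_mul_of_nonneg_right ?_ (sq_nonneg _)
  have h1 : u i ≤ 1 := by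
    rw [← hu.2]; exact single_le_sum (fun j _ => hu.1 j) (mem_univ i)
  have h2 : 1 ≤ p⁻¹ * v i := by
    rw [inv_mul_eq_div, one_le_div hp]; exact hv i
  exact h1.trans h2

lemma quadComparison_le_sq {u : Fin n → ℝ} (hu : u ∈ stdSimplex ℝ (Fin n)) {x : Fin n → ℝ} {d : ℝ}
    (hd : ∀ i j, x i - x j ≤ d) (i₀ : Fin n) : quadComparison u x ≤ d ^ 2 := by
  refine (quadComparison_le_sum hu.2 x (x i₀)).trans ?_
  calc ∑ i, u i * (x i - x i₀) ^ 2 ≤ ∑ i, u i * d ^ 2 := sum_le_sum fun i _ =>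
        mul_le_mul_of_nonneg_left (sq_le_sq' (by linarith [hd i₀ i]) (hd i i₀)) (hu.1 i)
    _ = d ^ 2 := by rw [← sum_mul, hu.2, one_mul]

/-- Some cut of the coordinates of `x` has a gap of at least `1 / (n - 1)` of the spread. -/
lemma exists_gap (hn : 2 ≤ n) (x : Fin n → ℝ) :
    ∃ (S : Finset (Fin n)) (g : ℝ), S.Nonempty ∧ S ≠ univ ∧ 0 ≤ g ∧
      (∀ i ∈ S, ∀ j ∈ Sᶜ, g ≤ x j - x i) ∧ ∀ i j, x i - x j ≤ ((n : ℝ) - 1) * g := by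
  obtain ⟨m, rfl⟩ : ∃ m, n = m + 1 := ⟨n - 1, by omega⟩
  set σ := Tuple.sort x
  have hmono : Monotone (x ∘ σ) := Tuple.monotone_sort x
  have : Nonempty (Fin m) := ⟨⟨0, by omega⟩⟩
  -- The largest of the `m = n - 1` consecutive gaps of the sorted values.
  obtain ⟨l, -, hl⟩ := exists_max_image (univ : Finset (Fin m))
    (fun l => x (σ l.succ) - x (σ l.castSucc)) univ_nonempty
  refine ⟨univ.filter fun i => σ.symm i ≤ l.castSucc, x (σ l.succ) - x (σ l.castSucc),
    ⟨σ l.castSucc, by simp⟩, fun h => ?_, ?_, fun i hi j hj => ?_, fun i j => ?_⟩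
  · have := h ▸ mem_univ (σ l.succ)
    simp [Fin.le_def] at this
  · exact sub_nonneg.2 (hmono (Fin.castSucc_lt_succ).le)
  · simp only [mem_compl, mem_filter, mem_univ, true_and, not_le] at hi hj
    have h1 := hmono hi
    have h2 := hmono (show l.succ ≤ σ.symm j from Fin.castSucc_lt_iff_succ_le.1 hj)
    simp only [Function.comp_apply, Equiv.apply_symm_apply] at h1 h2
    linarith
  · have htel : ∀ k : ℕ, ∀ hk : k < m + 1, x (σ ⟨k, hk⟩) - x (σ 0)
        ≤ k * (x (σ l.succ) - x (σ l.castSucc)) := fun k => by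
      induction k with
      | zero => intro hk; simp
      | succ k ih =>
        intro hk
        have h1 := ih (by omega)
        have h2 := hl ⟨k, by omega⟩ (mem_univ _)
        simp only [Fin.succ_mk, Fin.castSucc_mk] at h2
        push_cast
        linarith
    have h1 := htel m (by omega)
    have h2 := hmono (Fin.zero_le (σ.symm j))
    have h3 := hmono (show σ.symm i ≤ ⟨m, by omega⟩ from Fin.le_def.2 (by simp; omega))
    simp only [Function.comp_apply, Equiv.apply_symm_apply] at h2 h3
    push_cast
    linarith

/-- The disagreement of the neighbours, weighted by the matrix entries. -/
def disagreement (A : Matrix (Fin n) (Fin n) ℝ) (x : Fin n → ℝ) : ℝ :=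
  ∑ i, ∑ j, A i j * (x i - x j) ^ 2

lemma disagreement_nonneg {A : Matrix (Fin n) (Fin n) ℝ} (hA : ∀ i j, 0 ≤ A i j)
    (x : Fin n → ℝ) : 0 ≤ disagreement A x :=
  sum_nonneg fun i _ => sum_nonneg fun j _ => mul_nonneg (hA i j) (sq_nonneg _)

lemma cross_le_disagreement {A : Matrix (Fin n) (Fin n) ℝ} (hA : ∀ i j, 0 ≤ A i j)
    (x : Fin n → ℝ) (S : Finset (Fin n)) :
    ∑ i ∈ S, ∑ j ∈ Sᶜ, A i j * (x j - x i) ^ 2 + ∑ i ∈ Sᶜ, ∑ j ∈ S, A i j * (x i - x j) ^ 2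
      ≤ disagreement A x := by
  have h0 : ∀ i j, 0 ≤ A i j * (x i - x j) ^ 2 := fun i j => mul_nonneg (hA i j) (sq_nonneg _)
  rw [disagreement, ← sum_add_sum_compl S]
  refine add_le_add (sum_le_sum fun i _ => ?_) (sum_le_sum fun i _ => ?_)
  · simp only [fun j => show (x j - x i) ^ 2 = (x i - x j) ^ 2 by ring]
    exact sum_le_sum_of_subset_of_nonneg (subset_univ _) fun j _ _ => h0 i j
  · exact sum_le_sum_of_subset_of_nonneg (subset_univ _) fun j _ _ => h0 i j

/-- The first bound serves while gaps stay above `θ`; the second, from `(y - g) ^ 2 ≥ 0`, is linear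
in `y` and so charges for movement across the cut. -/
lemma sum_sq_cross_ge {S T : Finset (Fin n)} {c y : Fin n → Fin n → ℝ}
    (hc : ∀ i j, 0 ≤ c i j) {θ : ℝ} (hθ : 0 ≤ θ) (hy : ∀ i ∈ S, ∀ j ∈ T, θ ≤ y i j) (g : ℝ) :
    θ ^ 2 * ∑ i ∈ S, ∑ j ∈ T, c i j ≤ ∑ i ∈ S, ∑ j ∈ T, c i j * y i j ^ 2 ∧
    2 * g * ∑ i ∈ S, ∑ j ∈ T, c i j * y i j - g ^ 2 * ∑ i ∈ S, ∑ j ∈ T, c i j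
      ≤ ∑ i ∈ S, ∑ j ∈ T, c i j * y i j ^ 2 := by
  simp only [mul_sum, ← sum_sub_distrib]
  refine ⟨sum_le_sum fun i hi => sum_le_sum fun j hj => ?_,
    sum_le_sum fun i hi => sum_le_sum fun j hj => ?_⟩
  · rw [mul_comm]
    exact mul_le_mul_of_nonneg_left (pow_le_pow_left₀ hθ (hy i hi j hj) 2) (hc i j)
  · nlinarith [mul_nonneg (hc i j) (sq_nonneg (y i j - g))]

/-- One averaging step raises the values on `S` by at most the weighted cross differences. -/
lemma mulVec_le_of_le {A : Matrix (Fin n) (Fin n) ℝ} (hA : A ∈ Matrix.rowStochastic ℝ (Fin n))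
    {x : Fin n → ℝ} {S : Finset (Fin n)} {u : ℝ} (hu : ∀ i ∈ S, x i ≤ u)
    (hcross : ∀ i ∈ S, ∀ j ∈ Sᶜ, x i ≤ x j) {i : Fin n} (hi : i ∈ S) :
    Matrix.mulVec A x i ≤ u + ∑ i ∈ S, ∑ j ∈ Sᶜ, A i j * (x j - x i) := by
  have h1 : Matrix.mulVec A x i = u + ∑ j, A i j * (x j - u) := by
    simp only [mul_sub, sum_sub_distrib, ← sum_mul, Matrix.sum_row_of_mem_rowStochastic hA]
    simp only [Matrix.mulVec, dotProduct]; ring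
  rw [h1, ← sum_add_sum_compl S]
  have h2 : ∑ j ∈ S, A i j * (x j - u) ≤ 0 := sum_nonpos fun j hj =>
    mul_nonpos_of_nonneg_of_nonpos (hA.1 i j) (sub_nonpos.2 (hu j hj))
  have h3 : ∑ j ∈ Sᶜ, A i j * (x j - u) ≤ ∑ j ∈ Sᶜ, A i j * (x j - x i) :=
    sum_le_sum fun j _ => mul_le_mul_of_nonneg_left (by linarith [hu i hi]) (hA.1 i j)
  have h4 : ∑ j ∈ Sᶜ, A i j * (x j - x i) ≤ ∑ i ∈ S, ∑ j ∈ Sᶜ, A i j * (x j - x i) :=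
    single_le_sum (f := fun i => ∑ j ∈ Sᶜ, A i j * (x j - x i)) (fun i hi => sum_nonneg fun j hj =>
      mul_nonneg (hA.1 i j) (sub_nonneg.2 (hcross i hi j hj))) hi
  linarith

lemma mulVec_cross_ge {A : Matrix (Fin n) (Fin n) ℝ} (hA : A ∈ Matrix.rowStochastic ℝ (Fin n))
    {x : Fin n → ℝ} {S : Finset (Fin n)} {h : ℝ}
    (hcross : ∀ i ∈ S, ∀ j ∈ Sᶜ, x i ≤ x j) (hh : ∀ i ∈ S, ∀ j ∈ Sᶜ, h ≤ x j - x i)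
    {i j : Fin n} (hi : i ∈ S) (hj : j ∈ Sᶜ) :
    h - (∑ i ∈ S, ∑ j ∈ Sᶜ, A i j * (x j - x i) + ∑ i ∈ Sᶜ, ∑ j ∈ S, A i j * (x i - x j))
      ≤ Matrix.mulVec A x j - Matrix.mulVec A x i := by
  obtain ⟨a, ha, hamax⟩ := exists_max_image S x ⟨i, hi⟩
  -- The upper side is the lower side for `-x`, so `mulVec_le_of_le` bounds both movements.
  obtain ⟨b, hb, hbmin⟩ := exists_min_image Sᶜ x ⟨j, hj⟩
  have h1 := mulVec_le_of_le hA hamax hcross hi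
  have h2 := mulVec_le_of_le hA (x := -x) (S := Sᶜ) (u := -x b)
    (fun j hj => neg_le_neg (hbmin j hj))
    (fun j hj i hi => neg_le_neg (hcross i (by simpa using hi) j hj)) hj
  rw [Matrix.mulVec_neg, compl_compl] at h2
  simp only [Pi.neg_apply, neg_sub_neg] at h2
  have h3 := hh a ha b hb
  linarith

/-- If the flow across a cut with initial gap `g` reaches `δ`, the accumulated disagreement is at
least `δ (1 - δ)² g²`. -/
lemma sum_disagreement_ge {A : ℕ → Matrix (Fin n) (Fin n) ℝ}
    (hA : ∀ k, A k ∈ Matrix.rowStochastic ℝ (Fin n)) {x : ℕ → Fin n → ℝ}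
    (hx : ∀ k, x (k + 1) = Matrix.mulVec (A k) (x k)) {S : Finset (Fin n)} {g δ : ℝ} (hg : 0 ≤ g)
    (hδ0 : 0 < δ) (hδ1 : δ < 1) {s t : ℕ} (hst : s ≤ t)
    (hgap : ∀ i ∈ S, ∀ j ∈ Sᶜ, g ≤ x s j - x s i)
    (hflow : δ ≤ ∑ k ∈ Ico s t, (cutWeight (A k) S + cutWeight (A k) Sᶜ)) :
    δ * (1 - δ) ^ 2 * g ^ 2 ≤ ∑ k ∈ Ico s t, disagreement (A k) (x k) := by
  have h1δ : (1 - δ) ^ 2 ≤ 1 := by nlinarith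
  -- `L` accumulates the weighted cross differences and bounds how far the gap has closed. The
  -- invariant runs until the flow reaches `δ` or `L` exceeds `δ * g`; either event already gives
  -- the claim.
  have key : δ * (1 - δ) ^ 2 * g ^ 2 ≤ ∑ k ∈ Ico s t, disagreement (A k) (x k) ∨
      ∃ L : ℝ, (∀ i ∈ S, ∀ j ∈ Sᶜ, g - L ≤ x t j - x t i) ∧
        (1 - δ) ^ 2 * g ^ 2 * ∑ k ∈ Ico s t, (cutWeight (A k) S + cutWeight (A k) Sᶜ)
          ≤ ∑ k ∈ Ico s t, disagreement (A k) (x k) ∧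
        2 * g * L - g ^ 2 * ∑ k ∈ Ico s t, (cutWeight (A k) S + cutWeight (A k) Sᶜ)
          ≤ ∑ k ∈ Ico s t, disagreement (A k) (x k) := by
    clear hflow
    induction t, hst using Nat.le_induction with
    | base => exact Or.inr ⟨0, by simpa using hgap, by simp, by simp⟩
    | succ t hst ih =>
      have hD := disagreement_nonneg (hA t).1 (x t)
      rw [sum_Ico_succ_top hst, sum_Ico_succ_top hst]
      set Q := ∑ k ∈ Ico s t, disagreement (A k) (x k)
      set m := ∑ k ∈ Ico s t, (cutWeight (A k) S + cutWeight (A k) Sᶜ)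
      rcases ih with ih | ⟨L, hcr, h1, h2⟩
      · exact Or.inl (by linarith)
      by_cases hm : δ ≤ m
      · left
        have : (1 - δ) ^ 2 * g ^ 2 * δ ≤ (1 - δ) ^ 2 * g ^ 2 * m :=
          mul_le_mul_of_nonneg_left hm (by positivity)
        linarith
      push Not at hm
      by_cases hL : δ * g < L
      · left
        -- Here the gap closed early: `2 g L - g² m ≥ 2 δ g² - δ g² = δ g²`.
        have e1 : g ^ 2 * m ≤ g ^ 2 * δ := mul_le_mul_of_nonneg_left hm.le (sq_nonneg g)
        have e2 : 2 * g * (δ * g) ≤ 2 * g * L := mul_le_mul_of_nonneg_left hL.le (by positivity)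
        have e3 : (1 - δ) ^ 2 * (δ * g ^ 2) ≤ 1 * (δ * g ^ 2) :=
          mul_le_mul_of_nonneg_right h1δ (by positivity)
        nlinarith
      push Not at hL
      right
      have hθ : ∀ i ∈ S, ∀ j ∈ Sᶜ, (1 - δ) * g ≤ x t j - x t i := fun i hi j hj => by
        have := hcr i hi j hj; linarith
      have hθ0 : 0 ≤ (1 - δ) * g := mul_nonneg (by linarith) hg
      have hcross : ∀ i ∈ S, ∀ j ∈ Sᶜ, x t i ≤ x t j := fun i hi j hj => by
        have := hθ i hi j hj; linarith
      obtain ⟨a1, a2⟩ := sum_sq_cross_ge (S := S) (T := Sᶜ) (c := A t)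
        (y := fun i j => x t j - x t i) (hA t).1 hθ0 hθ g
      obtain ⟨b1, b2⟩ := sum_sq_cross_ge (S := Sᶜ) (T := S) (c := A t)
        (y := fun i j => x t i - x t j) (hA t).1 hθ0 (fun j hj i hi => hθ i hi j hj) g
      have hc := cross_le_disagreement (hA t).1 (x t) S
      have eS : cutWeight (A t) S = ∑ i ∈ S, ∑ j ∈ Sᶜ, A t i j := rfl
      have eSc : cutWeight (A t) Sᶜ = ∑ i ∈ Sᶜ, ∑ j ∈ S, A t i j := by
        rw [cutWeight, compl_compl]
      rw [← eS] at a1 a2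
      rw [← eSc] at b1 b2
      refine ⟨L + (∑ i ∈ S, ∑ j ∈ Sᶜ, A t i j * (x t j - x t i)
        + ∑ i ∈ Sᶜ, ∑ j ∈ S, A t i j * (x t i - x t j)), fun i hi j hj => ?_, ?_, ?_⟩
      · rw [hx, ← sub_sub]
        exact mulVec_cross_ge (hA t) hcross hcr hi hj
      · linarith
      · linarith
  rcases key with h | ⟨-, -, h, -⟩
  · exact h
  · have : (1 - δ) ^ 2 * g ^ 2 * δ ≤ _ := mul_le_mul_of_nonneg_left hflow (by positivity)
    linarith

lemma mul_quadComparison_le_sum_disagreement (hn : 2 ≤ n) {A : ℕ → Matrix (Fin n) (Fin n) ℝ}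
    (hA : ∀ k, A k ∈ Matrix.rowStochastic ℝ (Fin n)) {x : ℕ → Fin n → ℝ}
    (hx : ∀ k, x (k + 1) = Matrix.mulVec (A k) (x k)) {δ : ℝ}
    (hδ0 : 0 < δ) (hδ1 : δ < 1) {s t : ℕ} (hst : s ≤ t)
    (hflow : ∀ S : Finset (Fin n), S.Nonempty → S ≠ univ →
      δ ≤ ∑ k ∈ Ico s t, (cutWeight (A k) S + cutWeight (A k) Sᶜ))
    {u : Fin n → ℝ} (hu : u ∈ stdSimplex ℝ (Fin n)) :
    δ * (1 - δ) ^ 2 / ((n : ℝ) - 1) ^ 2 * quadComparison u (x s)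
      ≤ ∑ k ∈ Ico s t, disagreement (A k) (x k) := by
  obtain ⟨S, g, hS, hSu, hg, hgap, hd⟩ := exists_gap hn (x s)
  have hn1 : (0 : ℝ) < (n : ℝ) - 1 := by
    have : (2 : ℝ) ≤ n := by exact_mod_cast hn
    linarith
  refine le_trans ?_ (sum_disagreement_ge hA hx hg hδ0 hδ1 hst hgap (hflow S hS hSu))
  have h1 := quadComparison_le_sq hu hd ⟨0, by omega⟩
  calc δ * (1 - δ) ^ 2 / ((n : ℝ) - 1) ^ 2 * quadComparison u (x s)
      ≤ δ * (1 - δ) ^ 2 / ((n : ℝ) - 1) ^ 2 * (((n : ℝ) - 1) * g) ^ 2 :=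
        mul_le_mul_of_nonneg_left h1 (by positivity)
    _ = δ * (1 - δ) ^ 2 * g ^ 2 := by field_simp

end Disagreement

/-! ### Independence of the current state from the present and future matrices. -/

section Independence

variable {Ω : Type*} [MeasurableSpace Ω] {μ : Measure Ω}

lemma IndepFun.prodMk_left_of_prodMk_right {α β γ : Type*} [MeasurableSpace α] [MeasurableSpace β]
    [MeasurableSpace γ] [IsProbabilityMeasure μ] {X : Ω → α} {U : Ω → β} {V : Ω → γ}
    (hX : Measurable X) (hU : Measurable U) (hV : Measurable V)
    (hXUV : IndepFun X (fun ω => (U ω, V ω)) μ) (hUV : IndepFun U V μ) :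
    IndepFun (fun ω => (X ω, U ω)) V μ := by
  have hXU : IndepFun X U μ := hXUV.comp (φ := id) (ψ := Prod.fst) measurable_id measurable_fst
  rw [indepFun_iff_map_prod_eq_prod_map_map hX.aemeasurable hU.aemeasurable] at hXU
  rw [indepFun_iff_map_prod_eq_prod_map_map hU.aemeasurable hV.aemeasurable] at hUV
  rw [indepFun_iff_map_prod_eq_prod_map_map hX.aemeasurable (hU.prodMk hV).aemeasurable] at hXUV
  rw [indepFun_iff_map_prod_eq_prod_map_map (hX.prodMk hU).aemeasurable hV.aemeasurable, hXU]
  have := Measure.isProbabilityMeasure_map hX.aemeasurable (μ := μ)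
  have := Measure.isProbabilityMeasure_map hU.aemeasurable (μ := μ)
  have := Measure.isProbabilityMeasure_map hV.aemeasurable (μ := μ)
  rw [hUV] at hXUV
  -- On the level of laws, the claim is associativity of the product measure.
  apply (MeasurableEquiv.prodAssoc (α := α) (β := β) (γ := γ)).map_measurableEquiv_injective
  rw [Measure.prodAssoc_prod, ← hXUV,
    Measure.map_map MeasurableEquiv.prodAssoc.measurable ((hX.prodMk hU).prodMk hV)]
  rfl

variable {n : ℕ} {A : ℕ → Ω → Matrix (Fin n) (Fin n) ℝ} {x₀ : Ω → Fin n → ℝ}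

lemma measurable_matrix_apply {M : Ω → Matrix (Fin n) (Fin n) ℝ} (hM : Measurable M)
    (i j : Fin n) : Measurable fun ω => M ω i j :=
  (measurable_pi_apply j).comp ((measurable_pi_apply i).comp
    (show Measurable (fun ω => (M ω : Fin n → Fin n → ℝ)) from hM))


lemma measurable_trajectory (hx : Measurable x₀) {s : ℕ} (hA : ∀ t < s, Measurable (A t)) :
    Measurable (trajectory A x₀ s) := by
  induction s with
  | zero => exact hx
  | succ s ih =>
    have h1 := ih fun t ht => hA t (by omega)
    refine measurable_pi_lambda _ fun i => ?_
    simp only [trajectory, Matrix.mulVec, dotProduct]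
    exact Finset.measurable_sum _ fun j _ =>
      (measurable_matrix_apply (hA s s.lt_succ_self) i j).mul ((measurable_pi_apply j).comp h1)

lemma indepFun_trajectory [IsProbabilityMeasure μ] (hA : ∀ t, Measurable (A t))
    (hind : iIndepFun A μ) (hx : Measurable x₀) (hx₀ : IndepFun x₀ (fun ω t => A t ω) μ)
    (s t : ℕ) :
    IndepFun (trajectory A x₀ s) (fun ω (k : Finset.Ico s t) => A k ω) μ := by
  set U : Ω → (Finset.range s → Matrix (Fin n) (Fin n) ℝ) := fun ω k => A k ω with hU
  set V : Ω → (Finset.Ico s t → Matrix (Fin n) (Fin n) ℝ) := fun ω k => A k ω with hV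
  have hUm : Measurable U := measurable_pi_lambda _ fun k => hA k
  have hVm : Measurable V := measurable_pi_lambda _ fun k => hA k
  have hUV : IndepFun U V μ := hind.indepFun_finset _ _ (by
    rw [Finset.disjoint_left]
    intro k h1 h2
    simp at h1 h2
    omega) hA
  have hXUV : IndepFun x₀ (fun ω => (U ω, V ω)) μ :=
    hx₀.comp (φ := id) (ψ := fun f : ℕ → Matrix (Fin n) (Fin n) ℝ =>
      ((fun k : Finset.range s => f k), (fun k : Finset.Ico s t => f k))) measurable_id
      ((measurable_pi_lambda _ fun k => measurable_pi_apply _).prodMk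
        (measurable_pi_lambda _ fun k => measurable_pi_apply _))
  have hmain := IndepFun.prodMk_left_of_prodMk_right hx hUm hVm hXUV hUV
  rw [IndepFun_iff_Indep] at hmain ⊢
  refine indep_of_indep_of_le_left hmain ?_
  rw [← measurable_iff_comap_le]
  have hpast := comap_measurable (m := inferInstance) (fun ω => (x₀ ω, U ω))
  -- The state at time `s` is measurable for the σ-algebra generated by `x₀` and the matrices before
  -- `s`: the measurability lemma is applied with `Ω` carrying that σ-algebra.
  refine @measurable_trajectory Ω (MeasurableSpace.comap (fun ω => (x₀ ω, U ω)) inferInstance)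
    n A x₀ (measurable_fst.comp hpast) s fun k hk => ?_
  exact (measurable_pi_apply (⟨k, Finset.mem_range.2 hk⟩ : Finset.range s)).comp
    (measurable_snd.comp hpast)

end Independence

/-! ### Expected decrease over one step. -/

section OneStep

open Finset

variable {Ω : Type*} [MeasurableSpace Ω] {μ : Measure Ω} {n : ℕ}

lemma integrable_quadComparison {X : Ω → Fin n → ℝ}
    (hX : ∀ i, MemLp (fun ω => X ω i) 2 μ) (u : Fin n → ℝ) :
    Integrable (fun ω => quadComparison u (X ω)) μ := by
  simp only [quadComparison, dotProduct]
  refine integrable_finsetSum _ fun i _ => Integrable.const_mul ?_ _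
  exact MemLp.integrable_sq ((hX i).sub (memLp_finsetSum _ fun j _ => (hX j).const_mul _))

variable {M : Ω → Matrix (Fin n) (Fin n) ℝ} {X : Ω → Fin n → ℝ}

lemma ae_norm_apply_le_one (hstoch : ∀ᵐ ω ∂μ, M ω ∈ Matrix.rowStochastic ℝ (Fin n))
    (i j : Fin n) : ∀ᵐ ω ∂μ, ‖M ω i j‖ ≤ 1 := by
  filter_upwards [hstoch] with ω hω
  rw [Real.norm_of_nonneg (hω.1 i j)]
  exact Matrix.le_one_of_mem_rowStochastic hω

lemma integrable_apply_mul (hM : Measurable M)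
    (hstoch : ∀ᵐ ω ∂μ, M ω ∈ Matrix.rowStochastic ℝ (Fin n)) (i j : Fin n) {f : Ω → ℝ}
    (hf : Integrable f μ) : Integrable (fun ω => M ω i j * f ω) μ :=
  hf.bdd_mul (measurable_matrix_apply hM i j).aestronglyMeasurable (ae_norm_apply_le_one hstoch i j)

lemma memLp_mulVec (hM : Measurable M)
    (hstoch : ∀ᵐ ω ∂μ, M ω ∈ Matrix.rowStochastic ℝ (Fin n))
    (hX : ∀ i, MemLp (fun ω => X ω i) 2 μ) (i : Fin n) :
    MemLp (fun ω => Matrix.mulVec (M ω) (X ω) i) 2 μ := by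
  simp only [Matrix.mulVec, dotProduct]
  refine memLp_finsetSum _ fun j _ => ?_
  refine (hX j).of_le ((measurable_matrix_apply hM i j).aestronglyMeasurable.mul (hX j).1) ?_
  filter_upwards [ae_norm_apply_le_one hstoch i j] with ω hω
  rw [norm_mul]
  exact mul_le_of_le_one_left (norm_nonneg _) hω

lemma memLp_trajectory {A : ℕ → Ω → Matrix (Fin n) (Fin n) ℝ} {x₀ : Ω → Fin n → ℝ}
    (hA : IsIndependentRandomChain μ A) (hx : MemLp x₀ 2 μ) (t : ℕ) (i : Fin n) : MemLp (fun ω => trajectory A x₀ t ω i) 2 μ := by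
  induction t generalizing i with
  | zero => exact hx.eval i
  | succ t ih => exact memLp_mulVec (hA.measurable t) (hA.stochastic t) ih i

lemma integrable_disagreement (hM : Measurable M)
    (hstoch : ∀ᵐ ω ∂μ, M ω ∈ Matrix.rowStochastic ℝ (Fin n))
    (hX : ∀ i, MemLp (fun ω => X ω i) 2 μ) :
    Integrable (fun ω => disagreement (M ω) (X ω)) μ :=
  integrable_finsetSum _ fun i _ => integrable_finsetSum _ fun j _ =>
    integrable_apply_mul hM hstoch i j ((hX i).sub (hX j)).integrable_sq

/-- Each term is a matrix factor times a function of `x` and `c`, so independence splits its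
expectation. The centre is free so that it can be taken as `u ⬝ᵥ x`, a function of the state alone.
-/
lemma quadComparison_mulVec_le {B : Matrix (Fin n) (Fin n) ℝ}
    (hB : B ∈ Matrix.rowStochastic ℝ (Fin n)) {v : Fin n → ℝ} (hv : v ∈ stdSimplex ℝ (Fin n))
    (x : Fin n → ℝ) (c : ℝ) :
    quadComparison v (Matrix.mulVec B x)
      ≤ ∑ k, ∑ j, v k * (B k j * (x j ^ 2 - 2 * c * x j) - B k k * B k j * (x k - x j) ^ 2)
        + c ^ 2 := by
  refine (quadComparison_le_sum hv.2 _ c).trans ?_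
  rw [sum_mul_sub_sq hv.2]
  refine add_le_add ?_ le_rfl
  rw [dotProduct, mul_sum, ← sum_sub_distrib]
  refine sum_le_sum fun k _ => ?_
  have h := sq_sum_add_le_sum_sq (s := univ) (a := B k) (x := x) (fun j _ => hB.1 k j)
    (Matrix.sum_row_of_mem_rowStochastic hB k) (mem_univ k)
  have e : ∑ j, v k * (B k j * (x j ^ 2 - 2 * c * x j) - B k k * B k j * (x k - x j) ^ 2)
      = v k * (∑ j, B k j * x j ^ 2 - 2 * c * ∑ j, B k j * x j
        - B k k * ∑ j, B k j * (x k - x j) ^ 2) := by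
    simp only [mul_sum, ← sum_sub_distrib]
    exact sum_congr rfl fun j _ => by ring
  rw [e]
  have := mul_le_mul_of_nonneg_left h (hv.1 k)
  simp only [Matrix.mulVec, dotProduct]
  linarith

/-- Expected decrease of the quadratic comparison function in one step. -/
lemma integral_quadComparison_mulVec_add_le [IsProbabilityMeasure μ] (hM : Measurable M)
    (hstoch : ∀ᵐ ω ∂μ, M ω ∈ Matrix.rowStochastic ℝ (Fin n))
    (hXm : Measurable X) (hX : ∀ i, MemLp (fun ω => X ω i) 2 μ) (hind : IndepFun M X μ)
    {γ : ℝ} (hγ0 : 0 ≤ γ)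
    (hγ : ∀ i j, i ≠ j → γ * ∫ ω, M ω i j ∂μ ≤ ∫ ω, M ω i i * M ω i j ∂μ)
    {u v : Fin n → ℝ} (hu : u ∈ stdSimplex ℝ (Fin n)) (hv : v ∈ stdSimplex ℝ (Fin n))
    (huv : ∀ j, ∑ k, v k * ∫ ω, M ω k j ∂μ = u j) {p : ℝ} (hpv : ∀ i, p ≤ v i) :
    ∫ ω, quadComparison v (Matrix.mulVec (M ω) (X ω)) ∂μ
        + γ * p * ∫ ω, disagreement (M ω) (X ω) ∂μ
      ≤ ∫ ω, quadComparison u (X ω) ∂μ := by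
  have hdot : MemLp (fun ω => u ⬝ᵥ X ω) 2 μ := by
    simp only [dotProduct]
    exact memLp_finsetSum _ fun j _ => (hX j).const_mul _
  have hcX : ∀ j, Integrable (fun ω => X ω j ^ 2 - 2 * (u ⬝ᵥ X ω) * X ω j) μ := fun j => by
    refine (hX j).integrable_sq.sub ?_
    have := ((hdot.integrable_mul (hX j)).const_mul 2)
    simpa [mul_assoc] using this
  have hsq : ∀ i j, Integrable (fun ω => (X ω i - X ω j) ^ 2) μ := fun i j =>
    ((hX i).sub (hX j)).integrable_sq
  have hXi : ∀ j, Measurable fun x : Fin n → ℝ => x j := fun j => measurable_pi_apply j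
  have hmeasdot : Measurable fun x : Fin n → ℝ => u ⬝ᵥ x := by
    simp only [dotProduct]
    exact Finset.measurable_sum _ fun j _ => (hXi j).const_mul _
  have hI1 : ∀ k j, Integrable
      (fun ω => M ω k j * (X ω j ^ 2 - 2 * (u ⬝ᵥ X ω) * X ω j)) μ := fun k j =>
    integrable_apply_mul hM hstoch k j (hcX j)
  have hI2 : ∀ k j, Integrable (fun ω => M ω k k * M ω k j * (X ω k - X ω j) ^ 2) μ :=
    fun k j => by
      simp only [mul_assoc]
      exact integrable_apply_mul hM hstoch k k (integrable_apply_mul hM hstoch k j (hsq k j))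
  have hprod : ∀ (f : Matrix (Fin n) (Fin n) ℝ → ℝ) (h : (Fin n → ℝ) → ℝ), Measurable f →
      Measurable h → ∫ ω, f (M ω) * h (X ω) ∂μ = (∫ ω, f (M ω) ∂μ) * ∫ ω, h (X ω) ∂μ :=
    fun f h hf hh => hind.integral_fun_comp_mul_comp hM.aemeasurable hXm.aemeasurable
      hf.aestronglyMeasurable hh.aestronglyMeasurable
  have hentry : ∀ i j, Measurable fun B : Matrix (Fin n) (Fin n) ℝ => B i j := fun i j =>
    measurable_matrix_apply measurable_id i j
  have hE1 : ∀ k j, ∫ ω, M ω k j * (X ω j ^ 2 - 2 * (u ⬝ᵥ X ω) * X ω j) ∂μ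
      = (∫ ω, M ω k j ∂μ) * ∫ ω, (X ω j ^ 2 - 2 * (u ⬝ᵥ X ω) * X ω j) ∂μ := fun k j =>
    hprod (fun B => B k j) (fun x => x j ^ 2 - 2 * (u ⬝ᵥ x) * x j) (hentry k j)
      (((hXi j).pow_const 2).sub ((hmeasdot.const_mul 2).mul (hXi j)))
  have hE2 : ∀ k j, γ * ∫ ω, M ω k j * (X ω k - X ω j) ^ 2 ∂μ
      ≤ ∫ ω, M ω k k * M ω k j * (X ω k - X ω j) ^ 2 ∂μ := fun k j => by
    by_cases hkj : k = j
    · subst hkj; simp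
    have hm : Measurable fun x : Fin n → ℝ => (x k - x j) ^ 2 := ((hXi k).sub (hXi j)).pow_const 2
    rw [hprod (fun B => B k j) (fun x => (x k - x j) ^ 2) (hentry k j) hm,
      hprod (fun B => B k k * B k j) (fun x => (x k - x j) ^ 2)
        ((hentry k k).mul (hentry k j)) hm, ← mul_assoc]
    exact mul_le_mul_of_nonneg_right (hγ k j hkj) (integral_nonneg fun ω => sq_nonneg _)
  have hD : ∫ ω, disagreement (M ω) (X ω) ∂μ
      = ∑ k, ∑ j, ∫ ω, M ω k j * (X ω k - X ω j) ^ 2 ∂μ := by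
    simp only [disagreement]
    rw [integral_finsetSum _ fun k _ => integrable_finsetSum _ fun j _ =>
      integrable_apply_mul hM hstoch k j (hsq k j)]
    exact sum_congr rfl fun k _ => integral_finsetSum _ fun j _ =>
      integrable_apply_mul hM hstoch k j (hsq k j)
  have hIrow : ∀ k j, Integrable (fun ω => v k * (M ω k j * (X ω j ^ 2 - 2 * (u ⬝ᵥ X ω) * X ω j)
      - M ω k k * M ω k j * (X ω k - X ω j) ^ 2)) μ := fun k j =>
    ((hI1 k j).sub (hI2 k j)).const_mul _
  have hbound : ∫ ω, quadComparison v (Matrix.mulVec (M ω) (X ω)) ∂μ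
      ≤ ∑ k, ∑ j, v k * ((∫ ω, M ω k j ∂μ) * ∫ ω, (X ω j ^ 2 - 2 * (u ⬝ᵥ X ω) * X ω j) ∂μ
          - ∫ ω, M ω k k * M ω k j * (X ω k - X ω j) ^ 2 ∂μ) + ∫ ω, (u ⬝ᵥ X ω) ^ 2 ∂μ := by
    have h1 : ∫ ω, quadComparison v (Matrix.mulVec (M ω) (X ω)) ∂μ
        ≤ ∫ ω, (∑ k, ∑ j, v k * (M ω k j * (X ω j ^ 2 - 2 * (u ⬝ᵥ X ω) * X ω j)
          - M ω k k * M ω k j * (X ω k - X ω j) ^ 2) + (u ⬝ᵥ X ω) ^ 2) ∂μ := by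
      refine integral_mono_ae (integrable_quadComparison (memLp_mulVec hM hstoch hX) v) ?_ ?_
      · exact (integrable_finsetSum _ fun k _ => integrable_finsetSum _ fun j _ => hIrow k j).add
          hdot.integrable_sq
      · filter_upwards [hstoch] with ω hω
        exact quadComparison_mulVec_le hω hv (X ω) (u ⬝ᵥ X ω)
    refine h1.trans_eq ?_
    rw [integral_add (integrable_finsetSum _ fun k _ => integrable_finsetSum _ fun j _ => hIrow k j)
      hdot.integrable_sq, integral_finsetSum _ fun k _ => integrable_finsetSum _ fun j _ => hIrow k j]
    congr 1
    refine sum_congr rfl fun k _ => ?_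
    rw [integral_finsetSum _ fun j _ => hIrow k j]
    refine sum_congr rfl fun j _ => ?_
    rw [integral_const_mul, integral_sub (hI1 k j) (hI2 k j), hE1]
  -- With `c = u ⬝ᵥ x` and expected column weights `u`, the part without disagreement is exactly
  -- `V_u`.
  have hU : ∑ j, u j * ∫ ω, (X ω j ^ 2 - 2 * (u ⬝ᵥ X ω) * X ω j) ∂μ + ∫ ω, (u ⬝ᵥ X ω) ^ 2 ∂μ
      = ∫ ω, quadComparison u (X ω) ∂μ := by
    simp only [← integral_const_mul]
    rw [← integral_finsetSum _ fun j _ => (hcX j).const_mul _, ← integral_add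
      (integrable_finsetSum _ fun j _ => (hcX j).const_mul _) hdot.integrable_sq]
    congr 1
    funext ω
    rw [quadComparison_eq hu.2]
    have : ∑ j, u j * (X ω j ^ 2 - 2 * (u ⬝ᵥ X ω) * X ω j)
        = ∑ j, u j * X ω j ^ 2 - 2 * (u ⬝ᵥ X ω) * ∑ j, u j * X ω j := by
      rw [mul_sum, ← sum_sub_distrib]
      exact sum_congr rfl fun j _ => by ring
    rw [this]
    simp only [dotProduct]
    ring
  have hfirst : ∑ k, ∑ j, v k * ((∫ ω, M ω k j ∂μ) *
      ∫ ω, (X ω j ^ 2 - 2 * (u ⬝ᵥ X ω) * X ω j) ∂μ)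
      = ∑ j, u j * ∫ ω, (X ω j ^ 2 - 2 * (u ⬝ᵥ X ω) * X ω j) ∂μ := by
    rw [sum_comm]
    refine sum_congr rfl fun j _ => ?_
    rw [← huv j, sum_mul]
    exact sum_congr rfl fun k _ => by ring
  have hsecond : γ * p * ∫ ω, disagreement (M ω) (X ω) ∂μ
      ≤ ∑ k, ∑ j, v k * ∫ ω, M ω k k * M ω k j * (X ω k - X ω j) ^ 2 ∂μ := by
    rw [hD]
    simp only [mul_sum]
    refine sum_le_sum fun k _ => sum_le_sum fun j _ => ?_
    have h0 : 0 ≤ ∫ ω, M ω k j * (X ω k - X ω j) ^ 2 ∂μ := integral_nonneg_of_ae (by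
      filter_upwards [hstoch] with ω hω
      exact mul_nonneg (hω.1 k j) (sq_nonneg _))
    calc γ * p * ∫ ω, M ω k j * (X ω k - X ω j) ^ 2 ∂μ
        = p * (γ * ∫ ω, M ω k j * (X ω k - X ω j) ^ 2 ∂μ) := by ring
      _ ≤ _ := mul_le_mul (hpv k) (hE2 k j) (mul_nonneg hγ0 h0) (hv.1 k)
  simp only [mul_sub, sum_sub_distrib] at hbound hfirst hU
  linarith

end OneStep

/-! ### Decrease along the random chain and contraction over a flow window. -/

section Chain

open Finset

variable {Ω : Type*} [MeasurableSpace Ω] {μ : Measure Ω} [IsProbabilityMeasure μ] {n : ℕ}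
  {A : ℕ → Ω → Matrix (Fin n) (Fin n) ℝ} {γ : ℝ}

lemma IsIndependentRandomChain.integrable_apply (hA : IsIndependentRandomChain μ A) (t : ℕ)
    (i j : Fin n) : Integrable (fun ω => A t ω i j) μ := by
  simpa using integrable_apply_mul (hA.measurable t) (hA.stochastic t) i j
    (integrable_const (1 : ℝ))

lemma IsIndependentRandomChain.expectedChain_mem_rowStochastic
    (hA : IsIndependentRandomChain μ A) (t : ℕ) :
    expectedChain μ A t ∈ Matrix.rowStochastic ℝ (Fin n) := by
  rw [Matrix.mem_rowStochastic_iff_sum]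
  refine ⟨fun i j => integral_nonneg_of_ae ?_, fun i => ?_⟩
  · filter_upwards [hA.stochastic t] with ω hω using hω.1 i j
  · simp only [expectedChain, Matrix.of_apply]
    rw [← integral_finsetSum _ fun j _ => hA.integrable_apply t i j]
    calc ∫ ω, ∑ j, A t ω i j ∂μ = ∫ _, (1 : ℝ) ∂μ := integral_congr_ae (by
          filter_upwards [hA.stochastic t] with ω hω
          exact Matrix.sum_row_of_mem_rowStochastic hω i)
      _ = 1 := by simp

/-- Feedback forces a uniformly positive diagonal of the expected chain. -/
lemma HasFeedback.le_expectedChain_diag (hA : IsIndependentRandomChain μ A)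
    (hγ : HasFeedback μ A γ) (t : ℕ) (i : Fin n) : γ / (γ + n) ≤ expectedChain μ A t i i := by
  have hstoch := hA.expectedChain_mem_rowStochastic t
  have hdiag : 0 ≤ expectedChain μ A t i i := hstoch.1 i i
  have hoff : ∀ j ∈ univ.erase i, γ * expectedChain μ A t i j ≤ expectedChain μ A t i i :=
    fun j hj => by
      refine (hγ.2 t i j (ne_of_mem_erase hj).symm).trans ?_
      refine integral_mono_ae (integrable_apply_mul (hA.measurable t) (hA.stochastic t) i i
        (hA.integrable_apply t i j)) (hA.integrable_apply t i i) ?_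
      filter_upwards [hA.stochastic t] with ω hω
      exact mul_le_of_le_one_right (hω.1 i i) (Matrix.le_one_of_mem_rowStochastic hω)
  have hrow := Matrix.sum_row_of_mem_rowStochastic hstoch i
  rw [← add_sum_erase _ _ (mem_univ i)] at hrow
  -- Summing over `j ≠ i` gives `γ (1 - ā_ii) ≤ n ā_ii`, with `n` as a crude count of the
  -- off-diagonal entries.
  have h1 := sum_le_sum hoff
  rw [← mul_sum, sum_const, nsmul_eq_mul] at h1
  have h2 : ((univ.erase i).card : ℝ) ≤ n := by
    exact_mod_cast (card_le_univ _).trans_eq (Fintype.card_fin n)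
  have h3 := mul_le_mul_of_nonneg_right h2 hdiag
  have hγ0 := hγ.1
  rw [div_le_iff₀ (by positivity)]
  have h4 : ∑ j ∈ univ.erase i, expectedChain μ A t i j = 1 - expectedChain μ A t i i := by linarith
  rw [h4] at h1
  linarith

variable {x₀ : Ω → Fin n → ℝ}

variable {π : ℕ → Fin n → ℝ} {p : ℝ}

lemma integral_quadComparison_add_sum_le (hA : IsIndependentRandomChain μ A)
    (hγ : HasFeedback μ A γ) (hπ : IsUniformlyPositiveAbsProbSeq (expectedChain μ A) π p)
    (hxm : Measurable x₀) (hx : MemLp x₀ 2 μ) (hind : IndepFun x₀ (fun ω t => A t ω) μ)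
    {s t : ℕ} (hst : s ≤ t) :
    ∫ ω, quadComparison (π t) (trajectory A x₀ t ω) ∂μ
        + γ * p * ∑ k ∈ Ico s t, ∫ ω, disagreement (A k ω) (trajectory A x₀ k ω) ∂μ
      ≤ ∫ ω, quadComparison (π s) (trajectory A x₀ s ω) ∂μ := by
  induction t, hst using Nat.le_induction with
  | base => simp
  | succ t hst ih =>
    have hindt : IndepFun (A t) (trajectory A x₀ t) μ :=
      ((indepFun_trajectory hA.measurable hA.indep hxm hind t (t + 1)).comp (φ := id)
        (ψ := fun f : Ico t (t + 1) → Matrix (Fin n) (Fin n) ℝ => f ⟨t, by simp⟩)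
        measurable_id (measurable_pi_apply (⟨t, by simp⟩ : Ico t (t + 1)))).symm
    have hstep := integral_quadComparison_mulVec_add_le (hA.measurable t) (hA.stochastic t)
      (measurable_trajectory hxm fun k _ => hA.measurable k) (memLp_trajectory hA hx t) hindt
      hγ.1.le (hγ.2 t) (hπ.1.1 t) (hπ.1.1 (t + 1)) (fun j => congrFun (hπ.1.2 t) j)
      (hπ.2.2 (t + 1))
    rw [sum_Ico_succ_top hst, mul_add]
    simp only [trajectory]
    linarith

/-- The event is a preimage under the matrices of `[s, t)`, which are independent of the state at
time `s`. -/
lemma integral_indicator_flowEvent_mul (hA : IsIndependentRandomChain μ A)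
    (hxm : Measurable x₀) (hind : IndepFun x₀ (fun ω t => A t ω) μ) (δ : ℝ) (s t : ℕ)
    {f : (Fin n → ℝ) → ℝ} (hf : Measurable f) :
    MeasurableSet (flowEvent A δ s t) ∧
    ∫ ω, (flowEvent A δ s t).indicator (fun ω => f (trajectory A x₀ s ω)) ω ∂μ
      = μ.real (flowEvent A δ s t) * ∫ ω, f (trajectory A x₀ s ω) ∂μ := by
  let V : Ω → (Ico s t → Matrix (Fin n) (Fin n) ℝ) := fun ω k => A k ω
  let G : Set (Ico s t → Matrix (Fin n) (Fin n) ℝ) :=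
    {B | ∀ S : Finset (Fin n), S.Nonempty → S ≠ univ →
      δ ≤ ∑ k ∈ (Ico s t).attach, (cutWeight (B k) S + cutWeight (B k) Sᶜ)}
  have hVm : Measurable V := measurable_pi_lambda _ fun k => hA.measurable k
  have hcut : ∀ (k : Ico s t) (S : Finset (Fin n)),
      Measurable fun B : Ico s t → Matrix (Fin n) (Fin n) ℝ => cutWeight (B k) S := fun k S => by
    simp only [cutWeight]
    exact Finset.measurable_sum _ fun i _ => Finset.measurable_sum _ fun j _ =>
      measurable_matrix_apply (measurable_pi_apply k) i j
  have hG : MeasurableSet G := by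
    simp only [G, Set.ofPred_forall]
    refine MeasurableSet.iInter fun S => MeasurableSet.iInter fun _ => MeasurableSet.iInter fun _ =>
      measurableSet_le measurable_const ?_
    exact Finset.measurable_sum _ fun k _ => (hcut k S).add (hcut k Sᶜ)
  have hE : flowEvent A δ s t = V ⁻¹' G := by
    ext ω
    simp only [flowEvent, Set.mem_ofPred_eq, Set.mem_preimage, G, V]
    refine forall_congr' fun S => ?_
    rw [sum_attach (Ico s t) fun k => cutWeight (A k ω) S + cutWeight (A k ω) Sᶜ]
  have hEm : MeasurableSet (flowEvent A δ s t) := hE ▸ hVm hG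
  refine ⟨hEm, ?_⟩
  have hprod := (indepFun_trajectory hA.measurable hA.indep hxm hind s t).symm
    |>.integral_fun_comp_mul_comp (f := G.indicator fun _ => (1 : ℝ)) (g := f)
    hVm.aemeasurable (measurable_trajectory hxm fun k _ => hA.measurable k).aemeasurable
    (measurable_const.indicator hG).aestronglyMeasurable hf.aestronglyMeasurable
  have h1 : ∀ ω, G.indicator (fun _ => (1 : ℝ)) (V ω)
      = (flowEvent A δ s t).indicator (fun _ => (1 : ℝ)) ω := fun ω => by
    rw [hE]; rfl
  have h2 : ∫ ω, G.indicator (fun _ => (1 : ℝ)) (V ω) ∂μ = μ.real (flowEvent A δ s t) := by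
    simp only [h1]
    rw [integral_indicator hEm]
    simp
  rw [← h2, ← hprod]
  congr 1
  funext ω
  change _ = G.indicator (fun _ => (1 : ℝ)) (V ω) * _
  rw [h1]
  by_cases h : ω ∈ flowEvent A δ s t <;> simp [h]

lemma integral_quadComparison_le_of_flow (hn : 2 ≤ n) (hA : IsIndependentRandomChain μ A)
    (hγ : HasFeedback μ A γ) (hπ : IsUniformlyPositiveAbsProbSeq (expectedChain μ A) π p)
    (hxm : Measurable x₀) (hx : MemLp x₀ 2 μ) (hind : IndepFun x₀ (fun ω t => A t ω) μ)
    {δ ε : ℝ} (hδ0 : 0 < δ) (hδ1 : δ < 1) {s t : ℕ} (hst : s ≤ t)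
    (hflow : ε ≤ μ.real (flowEvent A δ s t)) :
    ∫ ω, quadComparison (π t) (trajectory A x₀ t ω) ∂μ
      ≤ (1 - ε * δ * (1 - δ) ^ 2 * γ * p / ((n : ℝ) - 1) ^ 2)
        * ∫ ω, quadComparison (π s) (trajectory A x₀ s ω) ∂μ := by
  have hsum := integral_quadComparison_add_sum_le hA hγ hπ hxm hx hind hst
  have hqm : Measurable fun x : Fin n → ℝ => quadComparison (π s) x := by
    have hXi : ∀ j, Measurable fun x : Fin n → ℝ => x j := fun j => measurable_pi_apply j
    simp only [quadComparison, dotProduct]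
    exact Finset.measurable_sum _ fun i _ => (((hXi i).sub
      (Finset.measurable_sum _ fun j _ => (hXi j).const_mul _)).pow_const 2).const_mul _
  obtain ⟨hEm, hE⟩ := integral_indicator_flowEvent_mul hA hxm hind δ s t hqm
  set V := ∫ ω, quadComparison (π s) (trajectory A x₀ s ω) ∂μ
  have hV : 0 ≤ V := integral_nonneg fun ω => quadComparison_nonneg (hπ.1.1 s) _
  have hDint : ∀ k, Integrable (fun ω => disagreement (A k ω) (trajectory A x₀ k ω)) μ := fun k =>
    integrable_disagreement (hA.measurable k) (hA.stochastic k) (memLp_trajectory hA hx k)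
  have hqint : Integrable (fun ω => quadComparison (π s) (trajectory A x₀ s ω)) μ :=
    integrable_quadComparison (memLp_trajectory hA hx s) _
  have hD : δ * (1 - δ) ^ 2 / ((n : ℝ) - 1) ^ 2 * (μ.real (flowEvent A δ s t) * V)
      ≤ ∑ k ∈ Ico s t, ∫ ω, disagreement (A k ω) (trajectory A x₀ k ω) ∂μ := by
    rw [← hE, ← integral_const_mul, ← integral_finsetSum _ fun k _ => hDint k]
    refine integral_mono_ae ((hqint.indicator hEm).const_mul _)
      (integrable_finsetSum _ fun k _ => hDint k) ?_
    filter_upwards [ae_all_iff.2 hA.stochastic] with ω hω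
    by_cases h : ω ∈ flowEvent A δ s t
    · simp only [Set.indicator_of_mem h]
      exact mul_quadComparison_le_sum_disagreement hn hω
        (x := fun k => trajectory A x₀ k ω) (fun k => rfl) hδ0 hδ1 hst h (hπ.1.1 s)
    · simp only [Set.indicator_of_notMem h, mul_zero]
      exact sum_nonneg fun k _ => disagreement_nonneg (hω k).1 _
  have hn1 : (0 : ℝ) < (n : ℝ) - 1 := by
    have : (2 : ℝ) ≤ n := by exact_mod_cast hn
    linarith
  have hεV : δ * (1 - δ) ^ 2 / ((n : ℝ) - 1) ^ 2 * (ε * V)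
      ≤ δ * (1 - δ) ^ 2 / ((n : ℝ) - 1) ^ 2 * (μ.real (flowEvent A δ s t) * V) :=
    mul_le_mul_of_nonneg_left (mul_le_mul_of_nonneg_right hflow hV) (by positivity)
  have hfin := mul_le_mul_of_nonneg_left (hεV.trans hD) (mul_pos hγ.1 hπ.2.1).le
  calc ∫ ω, quadComparison (π t) (trajectory A x₀ t ω) ∂μ
      ≤ V - γ * p * (δ * (1 - δ) ^ 2 / ((n : ℝ) - 1) ^ 2 * (ε * V)) := by linarith
    _ = _ := by ring

end Chain

/-- A nonnegative sequence that contracts by `ρ` decays geometrically; `ρ ≥ 0` is not needed. -/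
lemma le_pow_mul_of_nonneg_of_le_mul {a : ℕ → ℝ} {ρ : ℝ} {q : ℕ} (h0 : ∀ r, 0 ≤ a r)
    (h : ∀ r < q, a (r + 1) ≤ ρ * a r) : a q ≤ ρ ^ q * a 0 := by
  induction q with
  | zero => simp
  | succ q ih =>
    have ih := ih fun r hr => h r (by omega)
    have hq := h q q.lt_succ_self
    rcases le_or_gt 0 ρ with hρ | hρ
    · calc a (q + 1) ≤ ρ * a q := hq
        _ ≤ ρ * (ρ ^ q * a 0) := mul_le_mul_of_nonneg_left ih hρ
        _ = _ := by ring
    -- For `ρ < 0`, nonnegativity of `a 1 ≤ ρ * a 0` forces `a 0 = 0`, and the last step alone gives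
    -- `a (q + 1) ≤ 0`.
    · have hz : a 0 = 0 := by
        have := h 0 (by omega)
        nlinarith [h0 0, h0 1]
      have h1 : ρ * a q ≤ 0 := mul_nonpos_of_nonpos_of_nonneg hρ.le (h0 q)
      rw [hz, mul_zero]
      linarith

theorem corollary3 {n : ℕ} (hn : 2 ≤ n) {Ω : Type*} [MeasurableSpace Ω]
    (μ : Measure Ω) [IsProbabilityMeasure μ]
    (A : ℕ → Ω → Matrix (Fin n) (Fin n) ℝ) (hA : IsIndependentRandomChain μ A)
    (γ : ℝ) (hγ : HasFeedback μ A γ)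
    (hrec : IsApproxReciprocal (expectedChain μ A)) :
    (∃ (π : ℕ → Fin n → ℝ) (p : ℝ), IsUniformlyPositiveAbsProbSeq (expectedChain μ A) π p) ∧
    ∀ (π : ℕ → Fin n → ℝ) (p : ℝ), IsUniformlyPositiveAbsProbSeq (expectedChain μ A) π p →
      ∀ (δ ε : ℝ), 0 < δ → δ < 1 → 0 < ε → ε ≤ 1 →
      ∀ x₀ : Ω → Fin n → ℝ, Measurable x₀ → MemLp x₀ 2 μ →
        IndepFun x₀ (fun ω t => A t ω) μ →
      ∀ (τ : ℕ → ℕ) (q : ℕ), IsFlowTimes μ A δ ε τ q →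
        (Integrable (fun ω => quadComparison (π (τ q)) (trajectory A x₀ (τ q) ω)) μ ∧
          ∫ ω, quadComparison (π (τ q)) (trajectory A x₀ (τ q) ω) ∂μ
            ≤ (1 - ε * δ * (1 - δ) ^ 2 * γ * p / ((n : ℝ) - 1) ^ 2) ^ q
              * ∫ ω, quadComparison (π 0) (x₀ ω) ∂μ) ∧
        ∀ u ∈ stdSimplex ℝ (Fin n),
          Integrable (fun ω => quadComparison u (trajectory A x₀ (τ q) ω)) μ ∧
          ∫ ω, quadComparison u (trajectory A x₀ (τ q) ω) ∂μ
            ≤ p⁻¹ * (1 - ε * δ * (1 - δ) ^ 2 * γ * p / ((n : ℝ) - 1) ^ 2) ^ q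
              * ∫ ω, quadComparison (π 0) (x₀ ω) ∂μ := by
  refine ⟨?_, ?_⟩
  · have hγ0 := hγ.1
    exact exists_isUniformlyPositiveAbsProbSeq (by omega) hA.expectedChain_mem_rowStochastic
      (η := γ / (γ + n)) (by positivity) (hγ.le_expectedChain_diag hA) hrec
  intro π p hπ δ ε hδ0 hδ1 _ _ x₀ hxm hx hind τ q hτ
  have hint : ∀ u, Integrable (fun ω => quadComparison u (trajectory A x₀ (τ q) ω)) μ := fun u =>
    integrable_quadComparison (memLp_trajectory hA hx (τ q)) u
  have hdecay := le_pow_mul_of_nonneg_of_le_mul (q := q)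
    (a := fun r => ∫ ω, quadComparison (π (τ r)) (trajectory A x₀ (τ r) ω) ∂μ)
    (fun r => integral_nonneg fun ω => quadComparison_nonneg (hπ.1.1 _) _)
    (fun r hr => integral_quadComparison_le_of_flow hn hA hγ hπ hxm hx hind hδ0 hδ1
      ((Nat.le_succ _).trans (hτ.2 r hr).1.1) (hτ.2 r hr).1.2)
  simp only [hτ.1, trajectory] at hdecay
  refine ⟨⟨hint _, hdecay⟩, fun u hu => ⟨hint u, ?_⟩⟩
  calc ∫ ω, quadComparison u (trajectory A x₀ (τ q) ω) ∂μ
      ≤ ∫ ω, p⁻¹ * quadComparison (π (τ q)) (trajectory A x₀ (τ q) ω) ∂μ :=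
        integral_mono (hint u) ((hint _).const_mul _) fun ω =>
          quadComparison_le_inv_mul hu hπ.2.1 (hπ.2.2 _) _
    _ = p⁻¹ * ∫ ω, quadComparison (π (τ q)) (trajectory A x₀ (τ q) ω) ∂μ := integral_const_mul _ _
    _ ≤ _ := by
      rw [mul_assoc]
      exact mul_le_mul_of_nonneg_left hdecay (inv_pos.2 hπ.2.1).le
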